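/- Let $M$ be a smooth (Hausdorff) finite-dimensional manifold with tangent bundle $\pi\colon TM\to M$, let $A\subseteq TM$ be open (its elements are called observers), and let $VA=\ker(d\pi)|_A$. Let $HA\subseteq TA$ be a nonlinear connection on $A$, i.e. a smooth subbundle with $TA=HA\oplus VA$. An $A$-anisotropic vector field $X$ (resp. $s$-form $\omega$) assigns to each $v\in A$, smoothly in $v$, a vector $X_v\in T_{\pi(v)}M$ (resp. an alternating $s$-linear form $\omega_v$ on $T_{\pi(v)}M$); vector fields on $M$ are regarded as the (isotropic) anisotropic vector fields $v\mapsto X_{\pi(v)}$. For an anisotropic vector field $X$, the horizontal lift $X^{H}$ is the section of $HA$ with $d\pi_v(X^{H}_v)=X_v$. The anisotropic Lie bracket of anisotropic vector fields $Z,X$ is $(\mathfrak l^{H}_ZX)_v:=d\pi_v\big([Z^{H},X^{H}]_v\big)$, and that of $Z$ and an anisotropic $s$-form $\omega$ is the anisotropic $s$-form $\mathfrak l^{H}_Z\omega$ given by $$(\mathfrak l^{H}_Z\omega)(X_1,\dots,X_s)=Z^{H}\big(\omega(X_1,\dots,X_s)\big)-\sum_{\nu=1}^s\omega(X_1,\dots,\mathfrak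 l^{H}_ZX_\nu,\dots,X_s)$$ for all (local) smooth vector fields $X_1,\dots,X_s$ on $M$. Let $Z$ be a smooth vector field on $M$, with (possibly only local) flow $\psi_t$. For $v\in A$ and $|t|$ small, let $P_t(v)\in T_{\psi_t(\pi(v))}M$ be the $HA$-parallel transport of $v$ along the integral curve $\tau\mapsto\psi_\tau(\pi(v))$ of $Z$, i.e. the value at $t$ of the vector field $V$ along this curve with $V(0)=v$, with values in $A$, and whose velocity as a curve in $A$ lies in $HA$. For an anisotropic $s$-form $\omega$ put $$(\psi_t^*\omega)_v(u_1,\dots,u_s):=\omega_{P_t(v)}\big(d\psi_t(u_1),\dots,d\psi_t(u_s)\big),\qquad u_1,\dots,u_s\in T_{\pi(v)}M.$$ Then, for every smooth anisotropic $s$-form $\omega$ ($s\ge 0$) and every $v\in A$, $$(\mathfrak l^{H}_Z\omega)_v=\lim_{t\to0}\frac{(\psi_t^*\omega)_v-\omega_v}{t}.$$ -/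

import Mathlib

open Set Filter Topology Manifold Bundle
open scoped ContDiff

noncomputable section

namespace AnisotropicLie

/-! `M` is a smooth manifold without boundary modelled on the finite-dimensional real vector
space `E`, and `A` is a set of tangent vectors (the observers). Objects on `A` are represented by
functions on the whole tangent bundle, whose values outside `A` are irrelevant. -/

variable {E : Type*} [NormedAddCommGroup E] [NormedSpace ℝ E]
  {M : Type*} [TopologicalSpace M] [ChartedSpace E M] [IsManifold 𝓘(ℝ, E) ∞ M]

/-- The tangent vector field `X` on `M` is smooth on the set `U`. -/
def SmoothFieldOn (X : ∀ x : M, TangentSpace 𝓘(ℝ, E) x) (U : Set M) : Prop :=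
  ContMDiffOn 𝓘(ℝ, E) 𝓘(ℝ, E).tangent ∞
    (fun x => (⟨x, X x⟩ : TangentBundle 𝓘(ℝ, E) M)) U

/-- The differential at `v` of the canonical projection `π : TM → M`. -/
def dproj (v : TangentBundle 𝓘(ℝ, E) M) :
    TangentSpace 𝓘(ℝ, E).tangent v →L[ℝ] TangentSpace 𝓘(ℝ, E) v.proj :=
  mfderiv 𝓘(ℝ, E).tangent 𝓘(ℝ, E)
    (fun w : TangentBundle 𝓘(ℝ, E) M => w.proj) v

/-- The vertical subspace `V_v A = ker dπ_v`. -/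
def verticalSpace (v : TangentBundle 𝓘(ℝ, E) M) :
    Submodule ℝ (TangentSpace 𝓘(ℝ, E).tangent v) :=
  LinearMap.ker (dproj v : TangentSpace 𝓘(ℝ, E).tangent v →ₗ[ℝ] TangentSpace 𝓘(ℝ, E) v.proj)

/-- A nonlinear connection on `A → M`: a smooth (horizontal) subbundle `HA` of `TA` such that
`TA = HA ⊕ VA`. Smoothness is the existence of smooth local frames of `HA`. -/
structure NonlinearConnection (A : Set (TangentBundle 𝓘(ℝ, E) M)) where
  /-- the horizontal subspace `H_v A` of `T_v A` -/
  horizontal : ∀ v : TangentBundle 𝓘(ℝ, E) M, Submodule ℝ (TangentSpace 𝓘(ℝ, E).tangent v)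
  isCompl : ∀ v ∈ A, IsCompl (horizontal v) (verticalSpace v)
  exists_frame : ∀ v₀ ∈ A, ∃ O : Set (TangentBundle 𝓘(ℝ, E) M), IsOpen O ∧ v₀ ∈ O ∧
    ∃ Y : Fin (Module.finrank ℝ E) → ∀ v : TangentBundle 𝓘(ℝ, E) M,
        TangentSpace 𝓘(ℝ, E).tangent v,
      (∀ i, ContMDiffOn 𝓘(ℝ, E).tangent 𝓘(ℝ, E).tangent.tangent ∞
        (fun v => (⟨v, Y i v⟩ :
          TangentBundle 𝓘(ℝ, E).tangent (TangentBundle 𝓘(ℝ, E) M))) O) ∧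
      ∀ v ∈ O ∩ A, horizontal v = Submodule.span ℝ (range fun i => Y i v)

/-- A smooth `A`-anisotropic `s`-form: an alternating `s`-linear form `η_v` on `T_{π(v)} M` for
each `v ∈ A`, depending smoothly on `v`, i.e. such that `v ↦ η_v(X₁, …, X_s)` is smooth for all
smooth local vector fields `X₁, …, X_s` on `M`. -/
structure AnisotropicForm (A : Set (TangentBundle 𝓘(ℝ, E) M)) (s : ℕ) where
  /-- the value `η_v` -/
  form : ∀ v : TangentBundle 𝓘(ℝ, E) M, TangentSpace 𝓘(ℝ, E) v.proj [⋀^Fin s]→ₗ[ℝ] ℝ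
  smooth : ∀ (U : Set M), IsOpen U → ∀ X : Fin s → ∀ x : M, TangentSpace 𝓘(ℝ, E) x,
    (∀ i, SmoothFieldOn (X i) U) →
      ContMDiffOn 𝓘(ℝ, E).tangent 𝓘(ℝ, ℝ) ∞
        (fun v : TangentBundle 𝓘(ℝ, E) M => form v fun i => X i v.proj)
        (A ∩ {v | v.proj ∈ U})

/-- The anisotropic vector field (`v ↦` a vector of `T_{π(v)} M`) given by a vector field on
`M`; such anisotropic fields are called isotropic. -/
def isotropic (X : ∀ x : M, TangentSpace 𝓘(ℝ, E) x) :
    ∀ v : TangentBundle 𝓘(ℝ, E) M, TangentSpace 𝓘(ℝ, E) v.proj :=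
  fun v => X v.proj

namespace NonlinearConnection

variable {A : Set (TangentBundle 𝓘(ℝ, E) M)} (N : NonlinearConnection A)

open Classical in
/-- The horizontal lift `Z^H` of an anisotropic vector field `Z`: for `v ∈ A`, `Z^H_v` is the only
vector of `H_v A` which `dπ_v` maps to `Z_v`. -/
def horizontalLift (Z : ∀ v : TangentBundle 𝓘(ℝ, E) M, TangentSpace 𝓘(ℝ, E) v.proj)
    (v : TangentBundle 𝓘(ℝ, E) M) : TangentSpace 𝓘(ℝ, E).tangent v :=
  if h : ∃ w ∈ N.horizontal v, dproj v w = Z v then h.choose else 0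

/-- The anisotropic Lie bracket `𝔩^H_Z X` of two anisotropic vector fields: the anisotropic vector
field given by the horizontal part of the commutator `[Z^H, X^H]`, i.e. by its image under `dπ`. -/
def lieBracketField (Z X : ∀ v : TangentBundle 𝓘(ℝ, E) M, TangentSpace 𝓘(ℝ, E) v.proj)
    (v : TangentBundle 𝓘(ℝ, E) M) : TangentSpace 𝓘(ℝ, E) v.proj :=
  dproj v (VectorField.mlieBracket 𝓘(ℝ, E).tangent
    (N.horizontalLift Z) (N.horizontalLift X) v)

/-- The value at `v` of the anisotropic Lie bracket `𝔩^H_Z η` of an anisotropic form on the vector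
fields `X₁, …, X_s` of `M`:
`(𝔩^H_Z η)(X₁, …, X_s) = Z^H(η(X₁, …, X_s)) - ∑ ν, η(X₁, …, 𝔩^H_Z X_ν, …, X_s)`. -/
def lieBracketForm {s : ℕ}
    (Z : ∀ v : TangentBundle 𝓘(ℝ, E) M, TangentSpace 𝓘(ℝ, E) v.proj)
    (η : AnisotropicForm A s) (X : Fin s → ∀ x : M, TangentSpace 𝓘(ℝ, E) x)
    (v : TangentBundle 𝓘(ℝ, E) M) : ℝ :=
  (show ℝ from mfderiv 𝓘(ℝ, E).tangent 𝓘(ℝ, ℝ)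
      (fun w : TangentBundle 𝓘(ℝ, E) M => η.form w fun i => X i w.proj) v
      (N.horizontalLift Z v)) -
    ∑ ν : Fin s, η.form v (Function.update (fun i => X i v.proj) ν
      (N.lieBracketField Z (isotropic (X ν)) v))

/-- `V`, a vector field along the curve `γ`, is a parallel observer field on the time set `J`:
it takes values in `A` and its velocity, as a curve in `A`, is horizontal. -/
def IsParallelOn (γ : ℝ → M) (V : ∀ t : ℝ, TangentSpace 𝓘(ℝ, E) (γ t)) (J : Set ℝ) : Prop :=
  ∀ t ∈ J, (⟨γ t, V t⟩ : TangentBundle 𝓘(ℝ, E) M) ∈ A ∧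
    MDifferentiableAt 𝓘(ℝ, ℝ) 𝓘(ℝ, E).tangent
      (fun τ => (⟨γ τ, V τ⟩ : TangentBundle 𝓘(ℝ, E) M)) t ∧
    mfderiv 𝓘(ℝ, ℝ) 𝓘(ℝ, E).tangent
      (fun τ => (⟨γ τ, V τ⟩ : TangentBundle 𝓘(ℝ, E) M)) t (1 : ℝ) ∈ N.horizontal ⟨γ t, V t⟩

open Classical in
/-- The parallel transport `P_t(v) ∈ T_{γ(t)} M` along `γ` of an observer `v` at `γ(0)`: the
value at `t` of a parallel observer field, on an open interval containing `0` and `t`, which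
starts at `v`. (If there is none, then `P_t(v)` is not defined, and takes the value `0`.) -/
def parallelTransport (γ : ℝ → M) (t : ℝ) (v : TangentBundle 𝓘(ℝ, E) M) :
    TangentSpace 𝓘(ℝ, E) (γ t) :=
  if h : ∃ V : ∀ τ : ℝ, TangentSpace 𝓘(ℝ, E) (γ τ),
      (⟨γ 0, V 0⟩ : TangentBundle 𝓘(ℝ, E) M) = v ∧
      ∃ a b : ℝ, 0 ∈ Ioo a b ∧ t ∈ Ioo a b ∧ N.IsParallelOn γ V (Ioo a b)
  then h.choose t else 0

end NonlinearConnection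

open Classical in
/-- The (maximal, possibly only local) flow `ψ_t(x)` of the vector field `Z`: the value at `t` of
an integral curve of `Z`, on an open interval containing `0` and `t`, which starts at `x`.
(If there is none, then `ψ_t(x)` is not defined, and takes the value `x`.) -/
def flow (Z : ∀ x : M, TangentSpace 𝓘(ℝ, E) x) (t : ℝ) (x : M) : M :=
  if h : ∃ γ : ℝ → M, γ 0 = x ∧
      ∃ a b : ℝ, 0 ∈ Ioo a b ∧ t ∈ Ioo a b ∧ IsMIntegralCurveOn γ Z (Ioo a b)
  then h.choose t else x

/-- The pullback by the flow `ψ_t` of `Z` of an anisotropic form: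
`(ψ_t^* η)_v(u₁, …, u_s) = η_{P_t(v)}(dψ_t(u₁), …, dψ_t(u_s))`, where `P_t(v)` is the parallel
transport of `v` along the integral curve `τ ↦ ψ_τ(π(v))` of `Z`. -/
def flowPullback {A : Set (TangentBundle 𝓘(ℝ, E) M)} (N : NonlinearConnection A)
    (Z : ∀ x : M, TangentSpace 𝓘(ℝ, E) x) (t : ℝ) {s : ℕ} (η : AnisotropicForm A s)
    (v : TangentBundle 𝓘(ℝ, E) M) : TangentSpace 𝓘(ℝ, E) v.proj [⋀^Fin s]→ₗ[ℝ] ℝ :=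
  (η.form ⟨flow Z t v.proj, N.parallelTransport (fun τ => flow Z τ v.proj) t v⟩).compLinearMap
    (mfderiv 𝓘(ℝ, E) 𝓘(ℝ, E) (flow Z t) v.proj :
      TangentSpace 𝓘(ℝ, E) v.proj →L[ℝ] TangentSpace 𝓘(ℝ, E) (flow Z t v.proj)).toLinearMap

end AnisotropicLie

end

/-!
Let `W` be the integral curve of the horizontal lift `Z^H` with `W 0 = v`. It projects to the
integral curve of `Z`, so it is the parallel transport of `v` along it, and in a chart the pulled
back form on `X₁, …, X_s` is `η_{W t}(dψ_t X₁, …, dψ_t X_s)`. Compare this with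
`η_{W t}(X₁, …, X_s)`, where the `X_i` are taken along the curve and whose derivative at `0` is
`Z^H(η(X₁, …, X_s))`. Both have the same value at `0`, so by the product rule their derivatives
differ only through those of the arguments: in the chart, `X_i` along the curve has derivative
`dX_i(Z)` and `dψ_t X_i` has derivative `dZ(X_i)`, and the difference of the two is `[Z, X_i]`.
Finally `𝔩^H_Z X_i = [Z, X_i]`, because horizontal lifts are `π`-related to the fields they lift.

The derivative `dψ_t` is the solution `D` of the variational equation along the integral curve: by
Grönwall's inequality the deviation of `ψ_t x - ψ_t x₀` from `D_t (x - x₀)` is `O(‖x - x₀‖²)`.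
Solving for the flow and `D` together shows that `D` has derivative `dZ` at `t = 0`.
-/

noncomputable section

namespace AnisotropicLie

section LocalFlow

variable {F G : Type*} [NormedAddCommGroup F] [NormedSpace ℝ F] [NormedAddCommGroup G]
  [NormedSpace ℝ G]

lemma gronwallBound_mul (c δ K ε x : ℝ) :
    gronwallBound (c * δ) K (c * ε) x = c * gronwallBound δ K ε x := by
  rcases eq_or_ne K 0 with rfl | hK
  · simp only [gronwallBound_K0]; ring
  · simp only [gronwallBound_of_K_ne_0 hK]; ring

lemma norm_le_gronwallBound_abs {r r' : ℝ → F} {δ K e T t : ℝ}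
    (hr : ∀ τ ∈ Ioo (-T) T, HasDerivAt r (r' τ) τ) (h0 : ‖r 0‖ ≤ δ)
    (hb : ∀ τ ∈ Ioo (-T) T, ‖r' τ‖ ≤ K * ‖r τ‖ + e) (ht : t ∈ Ioo (-T) T) :
    ‖r t‖ ≤ gronwallBound δ K e |t| := by
  wlog h : 0 ≤ t generalizing r r' t
  · have hneg {τ : ℝ} (hτ : τ ∈ Ioo (-T) T) : -τ ∈ Ioo (-T) T := ⟨neg_lt_neg hτ.2, neg_lt.1 hτ.1⟩
    simpa using this (r := fun τ => r (-τ)) (r' := fun τ => -r' (-τ)) (t := -t)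
      (fun τ hτ => by
        simpa [Function.comp_def] using (hr (-τ) (hneg hτ)).scomp τ (hasDerivAt_neg τ))
      (by simpa using h0) (fun τ hτ => by simpa using hb (-τ) (hneg hτ)) (hneg ht) (by linarith)
  have hsub : Icc 0 t ⊆ Ioo (-T) T := fun τ hτ =>
    ⟨by linarith [hτ.1, ht.2], hτ.2.trans_lt ht.2⟩
  simpa [abs_of_nonneg h] using norm_le_gronwallBound_of_norm_deriv_right_le
    (fun τ hτ => (hr τ (hsub hτ)).continuousAt.continuousWithinAt)
    (fun τ hτ => (hr τ (hsub (Ico_subset_Icc_self hτ))).hasDerivWithinAt) h0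
    (fun τ hτ => hb τ (hsub (Ico_subset_Icc_self hτ))) t ⟨h, le_rfl⟩

lemma norm_sub_sub_fderiv_le_of_lipschitzOnWith {f : F → G} {s : Set F} (hs : Convex ℝ s)
    {K : NNReal} (hf : ∀ x ∈ s, DifferentiableAt ℝ f x)
    (hK : LipschitzOnWith K (fderiv ℝ f) s) {p q : F}
    (hp : p ∈ s) (hq : q ∈ s) :
    ‖f q - f p - fderiv ℝ f p (q - p)‖ ≤ K * ‖q - p‖ ^ 2 := by
  have hseg : segment ℝ p q ⊆ s := hs.segment_subset hp hq
  have hbound : ∀ z ∈ segment ℝ p q, ‖fderiv ℝ f z - fderiv ℝ f p‖ ≤ K * ‖q - p‖ := fun z hz =>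
    (hK.norm_sub_le (hseg hz) hp).trans (by gcongr; exact norm_sub_le_of_mem_segment hz)
  rw [sq, ← mul_assoc]
  exact (convex_segment p q).norm_image_sub_le_of_norm_hasFDerivWithin_le'
    (fun z hz => (hf z (hseg hz)).hasFDerivAt.hasFDerivWithinAt) hbound
    (left_mem_segment ℝ p q) (right_mem_segment ℝ p q)

lemma exists_ball_lipschitzOnWith_fderiv {f : F → G} {x₀ : F} (hf : ContDiffAt ℝ 2 f x₀)
    {u : Set F} (hu : u ∈ 𝓝 x₀) :
    ∃ ρ > (0 : ℝ), ∃ (K : NNReal) (C : ℝ), Metric.ball x₀ ρ ⊆ u ∧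
      (∀ y ∈ Metric.ball x₀ ρ, DifferentiableAt ℝ f y ∧ ‖fderiv ℝ f y‖ ≤ C) ∧
      LipschitzOnWith K (fderiv ℝ f) (Metric.ball x₀ ρ) := by
  have hf' : ContDiffAt ℝ 1 (fderiv ℝ f) x₀ := hf.fderiv_right (by norm_num [one_add_one_eq_two])
  obtain ⟨K, s, hs, hK⟩ := hf'.exists_lipschitzOnWith
  have hdiff : ∀ᶠ y in 𝓝 x₀, DifferentiableAt ℝ f y :=
    (hf.eventually (by simp)).mono fun y hy => hy.differentiableAt (by norm_num)
  have hbound : ∀ᶠ y in 𝓝 x₀, ‖fderiv ℝ f y‖ < ‖fderiv ℝ f x₀‖ + 1 :=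
    hf'.continuousAt.norm.eventually (gt_mem_nhds (lt_add_one _))
  obtain ⟨ρ, hρ, hball⟩ := Metric.eventually_nhds_iff_ball.1
    ((Filter.eventually_mem_set.2 hs).and
      ((Filter.eventually_mem_set.2 hu).and (hdiff.and hbound)))
  exact ⟨ρ, hρ, K, _, fun y hy => (hball y hy).2.1,
    fun y hy => ⟨(hball y hy).2.2.1, (hball y hy).2.2.2.le⟩, hK.mono fun y hy => (hball y hy).1⟩

lemma norm_sub_sub_variational_le {f : F → F} {s : Set F} (hs : Convex ℝ s) {K : NNReal}
    {C d T t : ℝ} (hf : ∀ y ∈ s, DifferentiableAt ℝ f y ∧ ‖fderiv ℝ f y‖ ≤ C)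
    (hK : LipschitzOnWith K (fderiv ℝ f) s) {γ γ₀ : ℝ → F} {D : ℝ → F →L[ℝ] F}
    (hγ : ∀ τ ∈ Ioo (-T) T, HasDerivAt γ (f (γ τ)) τ ∧ γ τ ∈ s)
    (hγ₀ : ∀ τ ∈ Ioo (-T) T, HasDerivAt γ₀ (f (γ₀ τ)) τ ∧ γ₀ τ ∈ s)
    (hD0 : D 0 = ContinuousLinearMap.id ℝ F)
    (hD : ∀ τ ∈ Ioo (-T) T, HasDerivAt D ((fderiv ℝ f (γ₀ τ)).comp (D τ)) τ)
    (hd : ∀ τ ∈ Ioo (-T) T, ‖γ τ - γ₀ τ‖ ≤ d) (ht : t ∈ Ioo (-T) T) :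
    ‖γ t - γ₀ t - D t (γ 0 - γ₀ 0)‖ ≤ gronwallBound 0 C (K * d ^ 2) |t| := by
  refine norm_le_gronwallBound_abs (r := fun τ => γ τ - γ₀ τ - D τ (γ 0 - γ₀ 0)) (δ := 0)
    (r' := fun τ => f (γ τ) - f (γ₀ τ) - fderiv ℝ f (γ₀ τ) (D τ (γ 0 - γ₀ 0)))
    (fun τ hτ => ((hγ τ hτ).1.sub (hγ₀ τ hτ).1).sub (by
      simpa using (hD τ hτ).clm_apply (hasDerivAt_const τ (γ 0 - γ₀ 0))))
    (by simp [hD0]) (fun τ hτ => ?_) ht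
  have htaylor := norm_sub_sub_fderiv_le_of_lipschitzOnWith hs (fun y hy => (hf y hy).1) hK
    (hγ₀ τ hτ).2 (hγ τ hτ).2
  calc ‖f (γ τ) - f (γ₀ τ) - fderiv ℝ f (γ₀ τ) (D τ (γ 0 - γ₀ 0))‖
      = ‖fderiv ℝ f (γ₀ τ) (γ τ - γ₀ τ - D τ (γ 0 - γ₀ 0)) +
          (f (γ τ) - f (γ₀ τ) - fderiv ℝ f (γ₀ τ) (γ τ - γ₀ τ))‖ := by
        rw [map_sub _ (γ τ - γ₀ τ)]; congr 1; abel
    _ ≤ C * ‖γ τ - γ₀ τ - D τ (γ 0 - γ₀ 0)‖ + K * d ^ 2 := by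
        refine (norm_add_le _ _).trans (add_le_add
          (ContinuousLinearMap.le_of_opNorm_le _ (hf _ (hγ₀ τ hτ).2).2 _) (htaylor.trans ?_))
        have := hd τ hτ
        gcongr

lemma exists_localFlow_lipschitz_variational [CompleteSpace F] {f : F → F} {x₀ : F}
    (hf : ContDiffAt ℝ 2 f x₀) :
    ∃ ε > (0 : ℝ), ∃ (α : F → ℝ → F) (D : ℝ → F →L[ℝ] F) (L : ℝ),
      (∀ᶠ x in 𝓝 x₀, α x 0 = x ∧ ∀ t ∈ Ioo (-ε) ε,
        HasDerivAt (α x) (f (α x t)) t ∧ ‖α x t - α x₀ t‖ ≤ L * ‖x - x₀‖) ∧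
      D 0 = ContinuousLinearMap.id ℝ F ∧
      ∀ t ∈ Ioo (-ε) ε, HasDerivAt D ((fderiv ℝ f (α x₀ t)).comp (D t)) t := by
  have hf' : ContDiffAt ℝ 1 (fderiv ℝ f) x₀ := hf.fderiv_right (by norm_num [one_add_one_eq_two])
  let G : F × (F →L[ℝ] F) → F × (F →L[ℝ] F) := fun p => (f p.1, (fderiv ℝ f p.1).comp p.2)
  have hG : ContDiffAt ℝ 1 G (x₀, ContinuousLinearMap.id ℝ F) :=
    (ContDiffAt.comp (x₀, ContinuousLinearMap.id ℝ F) (f := Prod.fst)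
        (hf.of_le (by norm_num)) contDiffAt_fst).prodMk
      ((ContDiffAt.comp (x₀, ContinuousLinearMap.id ℝ F) (f := Prod.fst)
        hf' contDiffAt_fst).clm_comp contDiffAt_snd)
  obtain ⟨ε, hε, a, r, L₀, K, hr, hpl⟩ := IsPicardLindelof.of_contDiffAt_one hG
  obtain ⟨Φ, hΦ, L, hL⟩ :=
    (hpl 0).exists_forall_mem_closedBall_eq_hasDerivWithinAt_lipschitzOnWith
  simp only [zero_sub, zero_add] at hΦ hL
  have hmem : ∀ x ∈ Metric.closedBall x₀ (r : ℝ), (x, ContinuousLinearMap.id ℝ F) ∈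
      Metric.closedBall (x₀, ContinuousLinearMap.id ℝ F) (r : ℝ) := fun x hx => by
    simpa [Prod.dist_eq] using hx
  have hx₀ := hmem x₀ (Metric.mem_closedBall_self r.2)
  have hΦ' : ∀ p ∈ Metric.closedBall (x₀, ContinuousLinearMap.id ℝ F) (r : ℝ),
      ∀ t ∈ Ioo (-ε) ε, HasDerivAt (Φ p) (G (Φ p t)) t := fun p hp t ht =>
    ((hΦ p hp).2 t (Ioo_subset_Icc_self ht)).hasDerivAt (Icc_mem_nhds ht.1 ht.2)
  refine ⟨ε, hε, fun x t => (Φ (x, ContinuousLinearMap.id ℝ F) t).1,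
    fun t => (Φ (x₀, ContinuousLinearMap.id ℝ F) t).2, L, ?_,
    congrArg Prod.snd (hΦ _ hx₀).1, fun t ht => (hΦ' _ hx₀ t ht).snd⟩
  filter_upwards [Metric.closedBall_mem_nhds x₀ (NNReal.coe_pos.2 hr)] with x hx
  refine ⟨congrArg Prod.fst (hΦ _ (hmem x hx)).1, fun t ht => ⟨(hΦ' _ (hmem x hx) t ht).fst, ?_⟩⟩
  have hdist := (hL t (Ioo_subset_Icc_self ht)).dist_le_mul _ (hmem x hx) _ hx₀
  rw [Prod.dist_eq, Prod.dist_eq] at hdist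
  simpa [dist_eq_norm] using (le_max_left _ _).trans hdist

lemma tendsto_uncurry_of_norm_sub_le {G X : Type*} [SeminormedAddCommGroup G]
    [TopologicalSpace X] {α : G → X → G} {x₀ : G} {t₀ : X} {J : Set X} (hJ : J ∈ 𝓝 t₀) {L : ℝ}
    (h₀ : Tendsto (α x₀) (𝓝 t₀) (𝓝 x₀))
    (hL : ∀ᶠ x in 𝓝 x₀, ∀ t ∈ J, ‖α x t - α x₀ t‖ ≤ L * ‖x - x₀‖) :
    Tendsto (Function.uncurry α) (𝓝 x₀ ×ˢ 𝓝 t₀) (𝓝 x₀) := by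
  have hdiff : Tendsto (fun p : G × X => α p.1 p.2 - α x₀ p.2) (𝓝 x₀ ×ˢ 𝓝 t₀) (𝓝 0) := by
    have hlim : Tendsto (fun p : G × X => L * ‖p.1 - x₀‖) (𝓝 x₀ ×ˢ 𝓝 t₀) (𝓝 0) := by
      have : Tendsto (fun x => L * ‖x - x₀‖) (𝓝 x₀) (𝓝 0) := by
        simpa using (Continuous.tendsto (by fun_prop) x₀ : Tendsto (fun x => L * ‖x - x₀‖) _ _)
      exact this.comp tendsto_fst
    refine squeeze_zero_norm' ?_ hlim
    filter_upwards [hL.prod_mk (Filter.eventually_mem_set.2 hJ)] with p hp using hp.1 _ hp.2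
  simpa [Function.uncurry_def] using hdiff.add (h₀.comp tendsto_snd)

theorem exists_localFlow_hasFDerivAt [CompleteSpace F] {f : F → F} {x₀ : F}
    (hf : ContDiffAt ℝ 2 f x₀) {u : Set F} (hu : u ∈ 𝓝 x₀) :
    ∃ ε > (0 : ℝ), ∃ (α : F → ℝ → F) (D : ℝ → F →L[ℝ] F),
      (∀ᶠ x in 𝓝 x₀, α x 0 = x ∧
        ∀ t ∈ Ioo (-ε) ε, HasDerivAt (α x) (f (α x t)) t ∧ α x t ∈ u) ∧
      (∀ t ∈ Ioo (-ε) ε, HasFDerivAt (fun x => α x t) (D t) x₀) ∧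
      HasDerivAt D (fderiv ℝ f x₀) 0 := by
  obtain ⟨ε₀, hε₀, α, D, L, hα, hD0, hD⟩ := exists_localFlow_lipschitz_variational hf
  obtain ⟨ρ, hρ, K, C, hρu, hfρ, hK⟩ := exists_ball_lipschitzOnWith_fderiv hf hu
  have h0 : (0 : ℝ) ∈ Ioo (-ε₀) ε₀ := ⟨neg_lt_zero.2 hε₀, hε₀⟩
  have hα₀ : α x₀ 0 = x₀ := hα.self_of_nhds.1
  have hlim : Tendsto (Function.uncurry α) (𝓝 x₀ ×ˢ 𝓝 0) (𝓝 x₀) :=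
    tendsto_uncurry_of_norm_sub_le (Ioo_mem_nhds h0.1 h0.2)
      (by simpa only [hα₀] using (hα.self_of_nhds.2 0 h0).1.continuousAt.tendsto)
      (hα.mono fun x hx t ht => (hx.2 t ht).2)
  obtain ⟨V, hV, J, hJ, hVJ⟩ := Filter.mem_prod_iff.1 (hlim (Metric.ball_mem_nhds x₀ hρ))
  obtain ⟨ε₁, hε₁, hε₁J⟩ := Metric.mem_nhds_iff.1 (inter_mem hJ (Ioo_mem_nhds h0.1 h0.2))
  rw [Real.ball_eq_Ioo, zero_sub, zero_add] at hε₁J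
  have hflow : ∀ᶠ x in 𝓝 x₀, α x 0 = x ∧ ∀ t ∈ Ioo (-ε₁) ε₁,
      (HasDerivAt (α x) (f (α x t)) t ∧ α x t ∈ Metric.ball x₀ ρ) ∧
        ‖α x t - α x₀ t‖ ≤ L * ‖x - x₀‖ := by
    filter_upwards [hα, hV] with x hx hxV
    exact ⟨hx.1, fun t ht => ⟨⟨(hx.2 t (hε₁J ht).2).1, hVJ (mk_mem_prod hxV (hε₁J ht).1)⟩,
      (hx.2 t (hε₁J ht).2).2⟩⟩
  refine ⟨ε₁, hε₁, α, D, hflow.mono fun x hx => ⟨hx.1, fun t ht => ?_⟩, fun t ht => ?_, ?_⟩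
  · exact ⟨(hx.2 t ht).1.1, hρu (hx.2 t ht).1.2⟩
  · have herr : ∀ᶠ x in 𝓝 x₀, ‖α x t - α x₀ t - D t (x - x₀)‖ ≤
        gronwallBound 0 C (K * L ^ 2) |t| * ‖x - x₀‖ ^ 2 := by
      filter_upwards [hflow] with x hx
      have hle := norm_sub_sub_variational_le (convex_ball x₀ ρ) hfρ hK (fun τ hτ => (hx.2 τ hτ).1)
        (fun τ hτ => (hflow.self_of_nhds.2 τ hτ).1) hD0 (fun τ hτ => hD τ (hε₁J hτ).2)
        (fun τ hτ => (hx.2 τ hτ).2) ht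
      rw [hx.1, hα₀, show K * (L * ‖x - x₀‖) ^ 2 = ‖x - x₀‖ ^ 2 * (K * L ^ 2) by ring] at hle
      simpa [mul_comm] using hle.trans_eq (by simpa using gronwallBound_mul _ 0 C (K * L ^ 2) |t|)
    have hO : (fun x => α x t - α x₀ t - D t (x - x₀)) =O[𝓝 x₀] fun x => ‖x - x₀‖ ^ 2 :=
      .of_bound _ (herr.mono fun x hx => by simpa using hx)
    exact .of_isLittleO
      (hO.trans_isLittleO (by simpa using Asymptotics.isLittleO_pow_sub_sub x₀ one_lt_two))
  · simpa [hα₀, hD0] using hD 0 h0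

end LocalFlow

section Multilinear

variable {ι F G : Type*} [NormedAddCommGroup F] [NormedSpace ℝ F]
  [FiniteDimensional ℝ F] [NormedAddCommGroup G] [NormedSpace ℝ G]

lemma tendsto_multilinear_apply [Finite ι] {α : Type*} {l : Filter α}
    {S : α → MultilinearMap ℝ (fun _ : ι => F) G} {S₀ : (ι → F) → G}
    (hS : ∀ u, Tendsto (fun a => S a u) l (𝓝 (S₀ u))) {U : α → ι → F} {u : ι → F}
    (hU : Tendsto U l (𝓝 u)) :
    Tendsto (fun a => S a (U a)) l (𝓝 (S₀ u)) := by
  classical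
  have := Fintype.ofFinite ι
  rcases l.eq_or_neBot with rfl | hl
  · exact tendsto_bot
  let b := Module.finBasis ℝ F
  have hexpand (T : MultilinearMap ℝ (fun _ : ι => F) G) (w : ι → F) :
      T w = ∑ J : ι → Fin (Module.finrank ℝ F),
        (∏ i, b.coord (J i) (w i)) • T fun i => b (J i) := by
    conv_lhs => rw [show w = fun i => ∑ j, b.coord j (w i) • b j from
      funext fun i => (b.sum_repr (w i)).symm]
    simp only [MultilinearMap.map_sum, MultilinearMap.map_smul_univ]
  have hlim {W : α → ι → F} (hW : Tendsto W l (𝓝 u)) :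
      Tendsto (fun a => S a (W a)) l (𝓝 (∑ J : ι → Fin (Module.finrank ℝ F),
        (∏ i, b.coord (J i) (u i)) • S₀ fun i => b (J i))) := by
    simp only [fun a => hexpand (S a) (W a)]
    exact tendsto_finsetSum _ fun J _ => (tendsto_finsetProd _ fun i _ =>
      ((b.coord (J i)).continuous_of_finiteDimensional.tendsto (u i)).comp
        (tendsto_pi_nhds.1 hW i)).smul (hS _)
  rw [tendsto_nhds_unique (hS u) (hlim tendsto_const_nhds)]
  exact hlim hU

lemma hasDerivAt_multilinear_apply [Fintype ι] [DecidableEq ι]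
    {T : ℝ → MultilinearMap ℝ (fun _ : ι => F) G}
    {T' : (ι → F) → G} {t₀ : ℝ} (hT : ∀ u, HasDerivAt (fun t => T t u) (T' u) t₀)
    {U : ℝ → ι → F} {U' : ι → F} (hU : HasDerivAt U U' t₀) :
    HasDerivAt (fun t => T t (U t))
      (T' (U t₀) + ∑ i, T t₀ (Function.update (U t₀) i (U' i))) t₀ := by
  have hform : Tendsto (fun t => (t - t₀)⁻¹ • (T t (U t) - T t₀ (U t))) (𝓝[≠] t₀)
      (𝓝 (T' (U t₀))) :=
    tendsto_multilinear_apply (S := fun t => (t - t₀)⁻¹ • (T t - T t₀))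
      (fun u => hasDerivAt_iff_tendsto_slope.1 (hT u))
      (hU.continuousAt.tendsto.mono_left nhdsWithin_le_nhds)
  have hcont : Continuous (T t₀) := continuous_iff_continuousAt.2 fun u =>
    tendsto_multilinear_apply (S := fun _ => T t₀) (fun _ => tendsto_const_nhds) tendsto_id
  have hargs : HasDerivAt (fun t => T t₀ (U t))
      (∑ i, T t₀ (Function.update (U t₀) i (U' i))) t₀ := by
    have := (ContinuousMultilinearMap.hasFDerivAt ⟨T t₀, hcont⟩ (U t₀)).comp_hasDerivAt t₀ hU
    rwa [ContinuousMultilinearMap.linearDeriv_apply] at this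
  rw [hasDerivAt_iff_tendsto_slope] at hargs ⊢
  refine (hform.add hargs).congr fun t => ?_
  rw [slope_def_module, slope_def_module, ← smul_add]
  abel_nf

lemma hasDerivAt_multilinear_apply_of_eq [Fintype ι] [DecidableEq ι]
    {T : ℝ → MultilinearMap ℝ (fun _ : ι => F) G} {t₀ : ℝ}
    (hT : ∀ u, DifferentiableAt ℝ (fun t => T t u) t₀) {U V : ℝ → ι → F} {U' V' : ι → F}
    (hU : HasDerivAt U U' t₀) (hV : HasDerivAt V V' t₀) (hUV : U t₀ = V t₀) {d : G}
    (hd : HasDerivAt (fun t => T t (U t)) d t₀) :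
    HasDerivAt (fun t => T t (V t))
      (d - ∑ i, T t₀ (Function.update (V t₀) i (U' i - V' i))) t₀ := by
  have hdU := hd.unique (hasDerivAt_multilinear_apply (fun u => (hT u).hasDerivAt) hU)
  have hdV := hasDerivAt_multilinear_apply (fun u => (hT u).hasDerivAt) hV
  rw [hUV] at hdU
  convert hdV using 1
  simp only [MultilinearMap.map_update_sub, Finset.sum_sub_distrib]
  rw [hdU]
  abel

end Multilinear

section Commutator

variable {E H : Type*} [NormedAddCommGroup E] [NormedSpace ℝ E] [TopologicalSpace H]
  {I : ModelWithCorners ℝ E H} {N : Type*} [TopologicalSpace N] [ChartedSpace H N]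
  {G : Type*} [NormedAddCommGroup G] [NormedSpace ℝ G]

variable (I) in
/-- The vector field `Y` read in the chart at `p`, as a vector field on the model space. It is
meaningful only on the target of the chart. -/
def chartPullback (p : N) (Y : ∀ q : N, TangentSpace I q) : E → E :=
  VectorField.mpullbackWithin 𝓘(ℝ, E) I (extChartAt I p).symm Y (range I)

lemma eventuallyEq_comp_extChartAt_symm_comp {X : Type*} (F : N → X) {p q : N}
    (hq : q ∈ (extChartAt I p).source) :
    F =ᶠ[𝓝 q] (F ∘ (extChartAt I p).symm) ∘ extChartAt I p := by
  filter_upwards [extChartAt_source_mem_nhds' hq] with y hy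
  rw [Function.comp_apply, Function.comp_apply, (extChartAt I p).left_inv hy]

lemma contDiffAt_comp_extChartAt_symm [I.Boundaryless] {n : ℕ∞ω} [IsManifold I n N] {F : N → G}
    {p : N} (hF : ContMDiffAt I 𝓘(ℝ, G) n F p) :
    ContDiffAt ℝ n (F ∘ (extChartAt I p).symm) (extChartAt I p p) := by
  refine (ContMDiffAt.comp _ ?_ ((contMDiffOn_extChartAt_symm p).contMDiffAt
    (extChartAt_target_mem_nhds p))).contDiffAt
  rwa [(extChartAt I p).left_inv (mem_extChartAt_source p)]

section Smooth

variable [IsManifold I 1 N]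

lemma hasMFDerivAt_of_eventuallyEq_comp_extChartAt {F : N → G} {f : E → G} {p q : N}
    (hq : q ∈ (extChartAt I p).source) (hf : DifferentiableAt ℝ f (extChartAt I p q))
    (hF : F =ᶠ[𝓝 q] f ∘ extChartAt I p) :
    HasMFDerivAt I 𝓘(ℝ, G) F q
      ((fderiv ℝ f (extChartAt I p q)).comp (mfderiv I 𝓘(ℝ, E) (extChartAt I p) q)) :=
  (hf.hasFDerivAt.hasMFDerivAt.comp q
    (mdifferentiableAt_extChartAt (by simpa using hq)).hasMFDerivAt).congr_of_eventuallyEq hF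

lemma mvfderiv_of_eventuallyEq_comp_extChartAt {F : N → G} {f : E → G} {p q : N}
    (hq : q ∈ (extChartAt I p).source) (hf : DifferentiableAt ℝ f (extChartAt I p q))
    (hF : F =ᶠ[𝓝 q] f ∘ extChartAt I p) (w : TangentSpace I q) :
    mvfderiv I F q w =
      fderiv ℝ f (extChartAt I p q) (mvfderiv I (extChartAt I p) q w) := by
  rw [mvfderiv, (hasMFDerivAt_of_eventuallyEq_comp_extChartAt hq hf hF).mfderiv]
  rfl

lemma chartPullback_extChartAt {p q : N} (hq : q ∈ (extChartAt I p).source)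
    (Y : ∀ q : N, TangentSpace I q) :
    chartPullback I p Y (extChartAt I p q) = mvfderiv I (extChartAt I p) q (Y q) := by
  have hinv : (mfderivWithin 𝓘(ℝ, E) I (extChartAt I p).symm (range I)
      (extChartAt I p q)).inverse =
        mfderiv I 𝓘(ℝ, E) (extChartAt I p) ((extChartAt I p).symm (extChartAt I p q)) :=
    ContinuousLinearMap.inverse_eq
      (mfderivWithin_extChartAt_symm_comp_mfderiv_extChartAt ((extChartAt I p).map_source hq))
      (mfderiv_extChartAt_comp_mfderivWithin_extChartAt_symm ((extChartAt I p).map_source hq))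
  have hread : chartPullback I p Y (extChartAt I p q) = mvfderiv I (extChartAt I p)
      ((extChartAt I p).symm (extChartAt I p q)) (Y ((extChartAt I p).symm (extChartAt I p q))) :=
    congrArg (fun T : TangentSpace I _ →L[ℝ] E => T (Y _)) hinv
  rw [hread, (extChartAt I p).left_inv hq]

end Smooth

variable [IsManifold I 2 N] [I.Boundaryless]

lemma differentiableAt_chartPullback [CompleteSpace E] {p : N} {Y : ∀ q : N, TangentSpace I q}
    (hY : MDifferentiableAt I I.tangent (fun q => (⟨q, Y q⟩ : TangentBundle I N)) p) :
    DifferentiableAt ℝ (chartPullback I p Y) (extChartAt I p p) := by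
  have h := MDifferentiableWithinAt.differentiableWithinAt_mpullbackWithin_vectorField
    (hY.mdifferentiableWithinAt (s := univ))
  rw [preimage_univ, univ_inter] at h
  have hrange : DifferentiableWithinAt ℝ (chartPullback I p Y) (range I) (extChartAt I p p) := h
  rwa [I.range_eq_univ, differentiableWithinAt_univ] at hrange

lemma mvfderiv_extChartAt_mlieBracket (p : N) (V W : ∀ q : N, TangentSpace I q) :
    mvfderiv I (extChartAt I p) p (VectorField.mlieBracket I V W p) =
      VectorField.lieBracket ℝ (chartPullback I p V) (chartPullback I p W) (extChartAt I p p) := by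
  rw [VectorField.mlieBracket, VectorField.mlieBracketWithin_apply, preimage_univ, univ_inter,
    ← VectorField.lieBracketWithin_univ, ← I.range_eq_univ]
  exact (isInvertible_mfderiv_extChartAt (mem_extChartAt_source p)).self_apply_inverse _

lemma mvfderiv_apply_eventuallyEq {F : N → G} {p : N} (hF : ContMDiffAt I 𝓘(ℝ, G) 2 F p)
    (Y : ∀ q : N, TangentSpace I q) :
    (fun q => mvfderiv I F q (Y q)) =ᶠ[𝓝 p]
      (fun y => fderiv ℝ (F ∘ (extChartAt I p).symm) y (chartPullback I p Y y)) ∘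
        extChartAt I p := by
  filter_upwards [extChartAt_source_mem_nhds (I := I) p, (continuousAt_extChartAt p).eventually
    ((contDiffAt_comp_extChartAt_symm hF).eventually (by simp))] with q hq hfq
  rw [mvfderiv_of_eventuallyEq_comp_extChartAt hq (hfq.differentiableAt (by norm_num))
    (eventuallyEq_comp_extChartAt_symm_comp F hq), Function.comp_apply,
    chartPullback_extChartAt hq]

lemma differentiableAt_fderiv_apply_chartPullback [CompleteSpace E] {F : N → G} {p : N}
    (hF : ContMDiffAt I 𝓘(ℝ, G) 2 F p) {Y : ∀ q : N, TangentSpace I q}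
    (hY : MDifferentiableAt I I.tangent (fun q => (⟨q, Y q⟩ : TangentBundle I N)) p) :
    DifferentiableAt ℝ (fun y => fderiv ℝ (F ∘ (extChartAt I p).symm) y (chartPullback I p Y y))
      (extChartAt I p p) :=
  (((contDiffAt_comp_extChartAt_symm hF).fderiv_right (m := 1)
    (by norm_num [one_add_one_eq_two])).differentiableAt (by norm_num)).clm_apply
      (differentiableAt_chartPullback hY)

lemma mdifferentiableAt_mvfderiv_apply [CompleteSpace E] {F : N → G} {p : N}
    (hF : ContMDiffAt I 𝓘(ℝ, G) 2 F p) {Y : ∀ q : N, TangentSpace I q}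
    (hY : MDifferentiableAt I I.tangent (fun q => (⟨q, Y q⟩ : TangentBundle I N)) p) :
    MDifferentiableAt I 𝓘(ℝ, G) (fun q => mvfderiv I F q (Y q)) p :=
  (hasMFDerivAt_of_eventuallyEq_comp_extChartAt (mem_extChartAt_source p)
    (differentiableAt_fderiv_apply_chartPullback hF hY)
    (mvfderiv_apply_eventuallyEq hF Y)).mdifferentiableAt

lemma mvfderiv_apply_mlieBracket [CompleteSpace E] {F : N → G} {p : N}
    (hF : ContMDiffAt I 𝓘(ℝ, G) 2 F p) {V W : ∀ q : N, TangentSpace I q}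
    (hV : MDifferentiableAt I I.tangent (fun q => (⟨q, V q⟩ : TangentBundle I N)) p)
    (hW : MDifferentiableAt I I.tangent (fun q => (⟨q, W q⟩ : TangentBundle I N)) p) :
    mvfderiv I F p (VectorField.mlieBracket I V W p) =
      mvfderiv I (fun q => mvfderiv I F q (W q)) p (V p) -
        mvfderiv I (fun q => mvfderiv I F q (V q)) p (W p) := by
  have hp := mem_extChartAt_source (I := I) p
  have hf := contDiffAt_comp_extChartAt_symm hF
  rw [mvfderiv_of_eventuallyEq_comp_extChartAt hp (hf.differentiableAt (by norm_num))
      (eventuallyEq_comp_extChartAt_symm_comp F hp), mvfderiv_extChartAt_mlieBracket,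
    VectorField.fderiv_apply_lieBracket hf (by simp) (differentiableAt_chartPullback hW)
      (differentiableAt_chartPullback hV),
    mvfderiv_of_eventuallyEq_comp_extChartAt hp (differentiableAt_fderiv_apply_chartPullback hF hV)
      (mvfderiv_apply_eventuallyEq hF V),
    mvfderiv_of_eventuallyEq_comp_extChartAt hp (differentiableAt_fderiv_apply_chartPullback hF hW)
      (mvfderiv_apply_eventuallyEq hF W),
    chartPullback_extChartAt hp, chartPullback_extChartAt hp]

theorem mfderiv_mlieBracket_of_related [CompleteSpace E] {E' H' N' : Type*}
    [NormedAddCommGroup E'] [NormedSpace ℝ E'] [CompleteSpace E'] [TopologicalSpace H']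
    {I' : ModelWithCorners ℝ E' H'} [I'.Boundaryless] [TopologicalSpace N'] [ChartedSpace H' N']
    [IsManifold I' 2 N'] {f : N → N'} {p : N} (hf : ContMDiffAt I I' 2 f p)
    {V W : ∀ q : N, TangentSpace I q} {V' W' : ∀ q : N', TangentSpace I' q}
    (hV : MDifferentiableAt I I.tangent (fun q => (⟨q, V q⟩ : TangentBundle I N)) p)
    (hW : MDifferentiableAt I I.tangent (fun q => (⟨q, W q⟩ : TangentBundle I N)) p)
    (hV' : MDifferentiableAt I' I'.tangent (fun q => (⟨q, V' q⟩ : TangentBundle I' N')) (f p))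
    (hW' : MDifferentiableAt I' I'.tangent (fun q => (⟨q, W' q⟩ : TangentBundle I' N')) (f p))
    (hVV' : ∀ᶠ q in 𝓝 p, mfderiv I I' f q (V q) = V' (f q))
    (hWW' : ∀ᶠ q in 𝓝 p, mfderiv I I' f q (W q) = W' (f q)) :
    mfderiv I I' f p (VectorField.mlieBracket I V W p) =
      VectorField.mlieBracket I' V' W' (f p) := by
  let φ := extChartAt I' (f p)
  have hφ : ContMDiffAt I' 𝓘(ℝ, E') 2 φ (f p) := contMDiffAt_extChartAt
  have hchain {g : N' → E'} {q : N} (hg : MDifferentiableAt I' 𝓘(ℝ, E') g (f q))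
      (hfq : MDifferentiableAt I I' f q) (w : TangentSpace I q) :
      mvfderiv I (g ∘ f) q w = mvfderiv I' g (f q) (mfderiv I I' f q w) :=
    congrArg (fun T : TangentSpace I q →L[ℝ] E' => T w) (mfderiv_comp q hg hfq)
  have hfp : MDifferentiableAt I I' f p := hf.mdifferentiableAt (by norm_num)
  have hread {Y : ∀ q : N, TangentSpace I q} {Y' : ∀ q : N', TangentSpace I' q}
      (hYY' : ∀ᶠ q in 𝓝 p, mfderiv I I' f q (Y q) = Y' (f q))
      (hY' : MDifferentiableAt I' I'.tangent (fun q => (⟨q, Y' q⟩ : TangentBundle I' N')) (f p))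
      (w : TangentSpace I p) : mvfderiv I (fun q => mvfderiv I (φ ∘ f) q (Y q)) p w =
        mvfderiv I' (fun q => mvfderiv I' φ q (Y' q)) (f p) (mfderiv I I' f p w) := by
    have heq : (fun q => mvfderiv I (φ ∘ f) q (Y q)) =ᶠ[𝓝 p]
        (fun q => mvfderiv I' φ q (Y' q)) ∘ f := by
      filter_upwards [hYY', (contMDiffAt_iff_contMDiffAt_nhds (by simp)).1 hf,
        hf.continuousAt.eventually (chart_source_mem_nhds H' (f p))] with q hq hfq hsrc
      rw [hchain (mdifferentiableAt_extChartAt hsrc)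
        (hfq.mdifferentiableAt (by norm_num)), hq, Function.comp_apply]
    rw [← hchain (mdifferentiableAt_mvfderiv_apply hφ hY') hfp, mvfderiv, heq.mfderiv_eq]
    rfl
  refine (isInvertible_mfderiv_extChartAt (mem_extChartAt_source (I := I') (f p))).injective ?_
  change mvfderiv I' φ (f p) _ = mvfderiv I' φ (f p) _
  rw [← hchain (hφ.mdifferentiableAt (by norm_num)) hfp,
    mvfderiv_apply_mlieBracket (hφ.comp p hf) hV hW, mvfderiv_apply_mlieBracket hφ hV' hW',
    hread hWW' hW', hread hVV' hV', hVV'.self_of_nhds, hWW'.self_of_nhds]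

end Commutator

section Coefficients

variable {ι F G : Type*} [Fintype ι] [NormedAddCommGroup F] [NormedSpace ℝ F]
  [NormedAddCommGroup G] [NormedSpace ℝ G]

lemma exists_continuousLinearEquiv_apply_eq_sum {a : ι → G}
    (hcard : Fintype.card ι = Module.finrank ℝ G) (ha : Submodule.span ℝ (range a) = ⊤) :
    ∃ e : (ι → ℝ) ≃L[ℝ] G, ∀ c, e c = ∑ i, c i • a i := by
  let b := basisOfTopLeSpanOfCardEqFinrank a ha.ge hcard
  exact ⟨b.equivFun.symm.toContinuousLinearEquiv, fun c => by simp [b]⟩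

lemma exists_contMDiffAt_coefficients {H : Type*} [TopologicalSpace H]
    {J : ModelWithCorners ℝ F H} {P : Type*} [TopologicalSpace P] [ChartedSpace H P]
    {k : ℕ∞ω} {p : P} {a : ι → P → G} {z : P → G}
    (hcard : Fintype.card ι = Module.finrank ℝ G)
    (ha : ∀ i, ContMDiffAt J 𝓘(ℝ, G) k (a i) p) (hz : ContMDiffAt J 𝓘(ℝ, G) k z p)
    (hspan : ∀ᶠ q in 𝓝 p, Submodule.span ℝ (range fun i => a i q) = ⊤) :
    ∃ c : ι → P → ℝ, (∀ i, ContMDiffAt J 𝓘(ℝ, ℝ) k (c i) p) ∧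
      ∀ᶠ q in 𝓝 p, ∑ i, c i q • a i q = z q := by
  let B : P → (ι → ℝ) →L[ℝ] G := fun q =>
    ∑ i, (ContinuousLinearMap.proj (R := ℝ) (φ := fun _ => ℝ) i).smulRight (a i q)
  have hB : ContMDiffAt J 𝓘(ℝ, (ι → ℝ) →L[ℝ] G) k B p :=
    contMDiffAt_finsetSum fun i _ => (ContinuousLinearMap.smulRightL ℝ (ι → ℝ) G
      (ContinuousLinearMap.proj i)).contDiff.contDiffAt.contMDiffAt.comp p (ha i)
  have hBequiv {q : P} (hq : Submodule.span ℝ (range fun i => a i q) = ⊤) :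
      ∃ e : (ι → ℝ) ≃L[ℝ] G, (e : (ι → ℝ) →L[ℝ] G) = B q := by
    obtain ⟨e, he⟩ := exists_continuousLinearEquiv_apply_eq_sum hcard hq
    exact ⟨e, ContinuousLinearMap.ext fun c => by simp [B, he]⟩
  have hc : ContMDiffAt J 𝓘(ℝ, ι → ℝ) k (fun q => (B q).inverse (z q)) p := by
    obtain ⟨e, he⟩ := hBequiv hspan.self_of_nhds
    have hinv : ContDiffAt ℝ k ContinuousLinearMap.inverse (B p) := he ▸ contDiffAt_map_inverse e
    exact (hinv.contMDiffAt.comp p hB).clm_apply hz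
  refine ⟨fun i q => (B q).inverse (z q) i, contMDiffAt_pi_space.1 hc, hspan.mono fun q hq => ?_⟩
  obtain ⟨e, he⟩ := hBequiv hq
  have hsum (c : ι → ℝ) : ∑ i, c i • a i q = e c := by
    rw [← ContinuousLinearEquiv.coe_coe, he]
    simp [B]
  rw [hsum fun i => (B q).inverse (z q) i, ← he, ContinuousLinearMap.inverse_equiv]
  exact e.apply_symm_apply _

end Coefficients

variable {E : Type*} [NormedAddCommGroup E] [NormedSpace ℝ E]
  {M : Type*} [TopologicalSpace M] [ChartedSpace E M] [IsManifold 𝓘(ℝ, E) ∞ M]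

section ChartReading

/-- A tangent vector at `y` read in the chart at `x₀`, as a vector of the model space. It is
meaningful only when `y` lies in the chart. -/
def chartReading (x₀ y : M) : TangentSpace 𝓘(ℝ, E) y →L[ℝ] E :=
  mvfderiv 𝓘(ℝ, E) (extChartAt 𝓘(ℝ, E) x₀) y

/-- The local vector field, on the domain of the chart at `x₀`, which is constant, equal to `u`, in
this chart. -/
def chartField (x₀ : M) (u : E) (y : M) : TangentSpace 𝓘(ℝ, E) y :=
  (trivializationAt E (TangentSpace 𝓘(ℝ, E)) x₀).symmL ℝ y u

lemma chartReading_eq_continuousLinearMapAt {x₀ y : M} (hy : y ∈ (chartAt E x₀).source) :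
    chartReading x₀ y =
      (trivializationAt E (TangentSpace 𝓘(ℝ, E)) x₀).continuousLinearMapAt ℝ y := by
  rw [TangentBundle.continuousLinearMapAt_trivializationAt hy]
  rfl

lemma chartReading_apply {x₀ : M} {w : TangentBundle 𝓘(ℝ, E) M}
    (hw : w.proj ∈ (chartAt E x₀).source) :
    chartReading x₀ w.proj w.2 = (trivializationAt E (TangentSpace 𝓘(ℝ, E)) x₀ w).2 := by
  rw [chartReading_eq_continuousLinearMapAt hw]
  exact Trivialization.continuousLinearMapAt_apply_of_mem ℝ
    (trivializationAt E (TangentSpace 𝓘(ℝ, E)) x₀) (by simpa using hw) w.2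

lemma chartReading_chartField {x₀ y : M} (hy : y ∈ (chartAt E x₀).source) (u : E) :
    chartReading x₀ y (chartField x₀ u y) = u := by
  rw [chartReading_eq_continuousLinearMapAt hy]
  exact Trivialization.continuousLinearMapAt_symmL _ (by simpa using hy) u

lemma chartField_chartReading {x₀ y : M} (hy : y ∈ (chartAt E x₀).source)
    (w : TangentSpace 𝓘(ℝ, E) y) : chartField x₀ (chartReading x₀ y w) y = w := by
  rw [chartReading_eq_continuousLinearMapAt hy]
  exact Trivialization.symmL_continuousLinearMapAt _ (by simpa using hy) w

lemma smoothFieldOn_chartField (x₀ : M) (u : E) :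
    SmoothFieldOn (chartField x₀ u) (chartAt E x₀).source := by
  refine (Trivialization.contMDiffOn_section_baseSet_iff
    (trivializationAt E (TangentSpace 𝓘(ℝ, E)) x₀)).2
      ((contMDiffOn_const (c := u)).congr fun y hy => ?_)
  have hy' : y ∈ (chartAt E x₀).source := by simpa using hy
  rw [← chartReading_apply (w := ⟨y, chartField x₀ u y⟩) hy', chartReading_chartField hy']

lemma contMDiffAt_chartReading {F : Type*} [NormedAddCommGroup F] [NormedSpace ℝ F]
    {H : Type*} [TopologicalSpace H] {J : ModelWithCorners ℝ F H} {P : Type*} [TopologicalSpace P]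
    [ChartedSpace H P] {n : ℕ∞ω} {b : P → M}
    {X : ∀ q, TangentSpace 𝓘(ℝ, E) (b q)} {p : P}
    (hX : ContMDiffAt J 𝓘(ℝ, E).tangent n
      (fun q => (⟨b q, X q⟩ : TangentBundle 𝓘(ℝ, E) M)) p) :
    ContMDiffAt J 𝓘(ℝ, E) n (fun q => chartReading (b p) (b q) (X q)) p := by
  obtain ⟨hb, hX'⟩ := contMDiffAt_totalSpace.1 hX
  refine hX'.congr_of_eventuallyEq ?_
  filter_upwards [hb.continuousAt.preimage_mem_nhds (chart_source_mem_nhds E (b p))] with q hq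
  exact chartReading_apply (w := ⟨b q, X q⟩) hq

end ChartReading

section HorizontalLift

lemma contMDiff_tangentBundle_proj : ContMDiff 𝓘(ℝ, E).tangent 𝓘(ℝ, E) ∞
    (fun w : TangentBundle 𝓘(ℝ, E) M => w.proj) :=
  contMDiff_proj (TangentSpace 𝓘(ℝ, E))

lemma dproj_surjective (v : TangentBundle 𝓘(ℝ, E) M) : Function.Surjective (dproj v) := by
  obtain ⟨x, w⟩ := v
  have hx : x ∈ (chartAt E x).source := mem_chart_source E x
  obtain ⟨u, rfl⟩ : ∃ u, chartField x u x = w := ⟨_, chartField_chartReading hx w⟩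
  let σ : M → TangentBundle 𝓘(ℝ, E) M := fun y => ⟨y, chartField x u y⟩
  have hσ : MDifferentiableAt 𝓘(ℝ, E) 𝓘(ℝ, E).tangent σ x :=
    ((smoothFieldOn_chartField x u).contMDiffAt
      ((chartAt E x).open_source.mem_nhds hx)).mdifferentiableAt (by norm_num)
  have hcomp : (dproj (σ x)).comp (mfderiv 𝓘(ℝ, E) 𝓘(ℝ, E).tangent σ x) =
      ContinuousLinearMap.id ℝ (TangentSpace 𝓘(ℝ, E) x) :=
    (mfderiv_comp x (I' := 𝓘(ℝ, E).tangent) (mdifferentiableAt_proj (TangentSpace 𝓘(ℝ, E)))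
      hσ).symm.trans mfderiv_id
  exact fun ξ => ⟨mfderiv 𝓘(ℝ, E) 𝓘(ℝ, E).tangent σ x ξ, DFunLike.congr_fun hcomp ξ⟩

lemma contMDiffAt_dproj {v : TangentBundle 𝓘(ℝ, E) M}
    {Y : ∀ v : TangentBundle 𝓘(ℝ, E) M, TangentSpace 𝓘(ℝ, E).tangent v}
    (hY : ContMDiffAt 𝓘(ℝ, E).tangent 𝓘(ℝ, E).tangent.tangent ∞
      (fun w => (⟨w, Y w⟩ : TangentBundle 𝓘(ℝ, E).tangent (TangentBundle 𝓘(ℝ, E) M))) v) :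
    ContMDiffAt 𝓘(ℝ, E).tangent 𝓘(ℝ, E).tangent ∞
      (fun w => (⟨w.proj, dproj w (Y w)⟩ : TangentBundle 𝓘(ℝ, E) M)) v :=
  ContMDiffAt.comp (x := v)
    (contMDiff_tangentBundle_proj.contMDiff_tangentMap (m := ∞) (by norm_num) _) hY

lemma contMDiffAt_isotropic {v : TangentBundle 𝓘(ℝ, E) M} {X : ∀ x : M, TangentSpace 𝓘(ℝ, E) x}
    {U : Set M} (hX : SmoothFieldOn X U) (hU : U ∈ 𝓝 v.proj) :
    ContMDiffAt 𝓘(ℝ, E).tangent 𝓘(ℝ, E).tangent ∞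
      (fun w => (⟨w.proj, isotropic X w⟩ : TangentBundle 𝓘(ℝ, E) M)) v :=
  ContMDiffAt.comp (x := v) (hX.contMDiffAt hU) (contMDiff_tangentBundle_proj v)

namespace NonlinearConnection

variable {A : Set (TangentBundle 𝓘(ℝ, E) M)} (N : NonlinearConnection A)

lemma exists_mem_horizontal_dproj_eq {v : TangentBundle 𝓘(ℝ, E) M} (hv : v ∈ A)
    (ξ : TangentSpace 𝓘(ℝ, E) v.proj) : ∃ w ∈ N.horizontal v, dproj v w = ξ := by
  obtain ⟨w, rfl⟩ := dproj_surjective v ξ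
  obtain ⟨h, hh, k, hk, rfl⟩ := Submodule.mem_sup.1
    ((N.isCompl v hv).sup_eq_top ▸ Submodule.mem_top : w ∈ N.horizontal v ⊔ verticalSpace v)
  exact ⟨h, hh, by rw [map_add, show dproj v k = 0 from hk, add_zero]⟩

lemma injOn_dproj_horizontal {v : TangentBundle 𝓘(ℝ, E) M} (hv : v ∈ A) :
    InjOn (dproj v) (N.horizontal v : Set (TangentSpace 𝓘(ℝ, E).tangent v)) :=
  LinearMap.disjoint_ker_iff_injOn.1 (N.isCompl v hv).disjoint

lemma horizontalLift_mem {v : TangentBundle 𝓘(ℝ, E) M} (hv : v ∈ A)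
    (Z : ∀ v : TangentBundle 𝓘(ℝ, E) M, TangentSpace 𝓘(ℝ, E) v.proj) :
    N.horizontalLift Z v ∈ N.horizontal v := by
  rw [horizontalLift, dif_pos (N.exists_mem_horizontal_dproj_eq hv (Z v))]
  exact (N.exists_mem_horizontal_dproj_eq hv (Z v)).choose_spec.1

lemma dproj_horizontalLift {v : TangentBundle 𝓘(ℝ, E) M} (hv : v ∈ A)
    (Z : ∀ v : TangentBundle 𝓘(ℝ, E) M, TangentSpace 𝓘(ℝ, E) v.proj) :
    dproj v (N.horizontalLift Z v) = Z v := by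
  rw [horizontalLift, dif_pos (N.exists_mem_horizontal_dproj_eq hv (Z v))]
  exact (N.exists_mem_horizontal_dproj_eq hv (Z v)).choose_spec.2

lemma eq_horizontalLift {v : TangentBundle 𝓘(ℝ, E) M} (hv : v ∈ A)
    {Z : ∀ v : TangentBundle 𝓘(ℝ, E) M, TangentSpace 𝓘(ℝ, E) v.proj}
    {w : TangentSpace 𝓘(ℝ, E).tangent v} (hw : w ∈ N.horizontal v) (h : dproj v w = Z v) :
    w = N.horizontalLift Z v :=
  N.injOn_dproj_horizontal hv hw (N.horizontalLift_mem hv Z)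
    (h.trans (N.dproj_horizontalLift hv Z).symm)

section Frame

variable {ι : Type*} {Y : ι → ∀ v : TangentBundle 𝓘(ℝ, E) M, TangentSpace 𝓘(ℝ, E).tangent v}
  {x₀ : M} {v : TangentBundle 𝓘(ℝ, E) M}

lemma span_chartReading_dproj_eq_top (hv : v ∈ A) (hx₀ : v.proj ∈ (chartAt E x₀).source)
    (hY : N.horizontal v = Submodule.span ℝ (range fun i => Y i v)) :
    Submodule.span ℝ (range fun i => chartReading x₀ v.proj (dproj v (Y i v))) = ⊤ := by
  let L : TangentSpace 𝓘(ℝ, E).tangent v →ₗ[ℝ] E :=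
    ((chartReading x₀ v.proj).comp (dproj v)).toLinearMap
  have hmap : Submodule.span ℝ (range fun i => chartReading x₀ v.proj (dproj v (Y i v))) =
      (N.horizontal v).map L := by
    rw [hY, Submodule.map_span, ← range_comp]
    rfl
  rw [hmap, Submodule.eq_top_iff']
  intro ξ
  obtain ⟨y, hy, hyξ⟩ := N.exists_mem_horizontal_dproj_eq hv (chartField x₀ ξ v.proj)
  exact ⟨y, hy, (congrArg _ hyξ).trans (chartReading_chartField hx₀ ξ)⟩

lemma sum_smul_eq_horizontalLift [Fintype ι] {c : ι → ℝ}
    {Z : ∀ v : TangentBundle 𝓘(ℝ, E) M, TangentSpace 𝓘(ℝ, E) v.proj} (hv : v ∈ A)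
    (hx₀ : v.proj ∈ (chartAt E x₀).source)
    (hY : N.horizontal v = Submodule.span ℝ (range fun i => Y i v))
    (hc : ∑ i, c i • chartReading x₀ v.proj (dproj v (Y i v)) = chartReading x₀ v.proj (Z v)) :
    ∑ i, c i • Y i v = N.horizontalLift Z v := by
  refine N.eq_horizontalLift hv ?_ ?_
  · rw [hY]
    exact Submodule.sum_mem _ fun i _ => Submodule.smul_mem _ _ (Submodule.subset_span ⟨i, rfl⟩)
  · have hread : chartReading x₀ v.proj (dproj v (∑ i, c i • Y i v)) =
        chartReading x₀ v.proj (Z v) := by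
      simpa only [map_sum, map_smul] using hc
    simpa only [chartField_chartReading hx₀] using congrArg (chartField x₀ · v.proj) hread

end Frame

lemma contMDiffAt_horizontalLift (hA : IsOpen A)
    {v : TangentBundle 𝓘(ℝ, E) M} (hv : v ∈ A)
    {Z : ∀ v : TangentBundle 𝓘(ℝ, E) M, TangentSpace 𝓘(ℝ, E) v.proj}
    (hZ : ContMDiffAt 𝓘(ℝ, E).tangent 𝓘(ℝ, E).tangent ∞
      (fun w => (⟨w.proj, Z w⟩ : TangentBundle 𝓘(ℝ, E) M)) v) :
    ContMDiffAt 𝓘(ℝ, E).tangent 𝓘(ℝ, E).tangent.tangent ∞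
      (fun w => (⟨w, N.horizontalLift Z w⟩ :
        TangentBundle 𝓘(ℝ, E).tangent (TangentBundle 𝓘(ℝ, E) M))) v := by
  obtain ⟨O, hO, hvO, Y, hYO, hspan⟩ := N.exists_frame v hv
  have hY (i) : ContMDiffAt 𝓘(ℝ, E).tangent 𝓘(ℝ, E).tangent.tangent ∞
      (fun w => (⟨w, Y i w⟩ : TangentBundle 𝓘(ℝ, E).tangent (TangentBundle 𝓘(ℝ, E) M))) v :=
    (hYO i).contMDiffAt (hO.mem_nhds hvO)
  have hnear : ∀ᶠ w in 𝓝 v, (w ∈ O ∩ A) ∧ w.proj ∈ (chartAt E v.proj).source :=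
    (Filter.eventually_mem_set.2 ((hO.inter hA).mem_nhds ⟨hvO, hv⟩)).and
      ((contMDiff_tangentBundle_proj v).continuousAt.eventually (chart_source_mem_nhds E v.proj))
  obtain ⟨c, hc, hcZ⟩ := exists_contMDiffAt_coefficients (Fintype.card_fin _)
    (fun i => contMDiffAt_chartReading (contMDiffAt_dproj (hY i))) (contMDiffAt_chartReading hZ)
    (hnear.mono fun w hw => N.span_chartReading_dproj_eq_top hw.1.2 hw.2 (hspan w hw.1))
  refine (ContMDiffAt.sum_section (s := Finset.univ)
    fun i _ => (hc i).smul_section (hY i)).congr_of_eventuallyEq ?_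
  filter_upwards [hnear, hcZ] with w hw hcw
  exact congrArg (TotalSpace.mk w)
    (N.sum_smul_eq_horizontalLift hw.1.2 hw.2 (hspan w hw.1) hcw).symm

end NonlinearConnection

end HorizontalLift

section IntegralCurves

lemma t2Space_totalSpace {B F : Type*} [TopologicalSpace B] [T2Space B] [TopologicalSpace F]
    [T2Space F] (V : B → Type*) [TopologicalSpace (TotalSpace F V)]
    [∀ b, TopologicalSpace (V b)] [FiberBundle F V] : T2Space (TotalSpace F V) := by
  refine ⟨fun x y hxy => ?_⟩
  by_cases h : x.proj = y.proj
  · let e := trivializationAt F V x.proj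
    have hx : x ∈ e.source := e.mem_source.2 (mem_baseSet_trivializationAt F V x.proj)
    have hy : y ∈ e.source := e.mem_source.2 (h ▸ mem_baseSet_trivializationAt F V x.proj)
    obtain ⟨u, w, hu, hw, hxu, hyw, huw⟩ := t2_separation (e.injOn.ne hx hy hxy)
    exact ⟨e.source ∩ e ⁻¹' u, e.source ∩ e ⁻¹' w,
      e.toOpenPartialHomeomorph.isOpen_inter_preimage hu,
      e.toOpenPartialHomeomorph.isOpen_inter_preimage hw, ⟨hx, hxu⟩, ⟨hy, hyw⟩,
      (huw.preimage e).mono inter_subset_right inter_subset_right⟩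
  · exact separated_by_continuous (FiberBundle.continuous_proj F V) h

variable {F H P : Type*} [NormedAddCommGroup F] [NormedSpace ℝ F] [TopologicalSpace H]
  {I : ModelWithCorners ℝ F H} [TopologicalSpace P] [ChartedSpace H P]
  {γ γ' : ℝ → P} {Y : ∀ p : P, TangentSpace I p} {J : Set ℝ} {t₀ : ℝ}

lemma isMIntegralCurveOn_iff_mfderiv_one (hJ : IsOpen J) :
    IsMIntegralCurveOn γ Y J ↔ ∀ t ∈ J, MDifferentiableAt 𝓘(ℝ, ℝ) I γ t ∧
      mfderiv 𝓘(ℝ, ℝ) I γ t (1 : ℝ) = Y (γ t) := by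
  refine forall₂_congr fun t ht => ⟨fun h => ?_, fun ⟨hd, h⟩ => ?_⟩
  · have hγ := h.hasMFDerivAt (hJ.mem_nhds ht)
    exact ⟨hγ.mdifferentiableAt,
      (DFunLike.congr_fun hγ.mfderiv (1 : ℝ)).trans (one_smul ℝ (Y (γ t) : F))⟩
  · exact hd.hasMFDerivAt.hasMFDerivWithinAt.congr_mfderiv
      (ContinuousLinearMap.ext_ring (h.trans (one_smul ℝ (Y (γ t) : F)).symm))

lemma isMIntegralCurveOn_congr (hγ : IsMIntegralCurveOn γ Y J) (h : EqOn γ' γ J) :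
    IsMIntegralCurveOn γ' Y J := fun t ht =>
  ((hγ t ht).congr_mono h (h ht) subset_rfl).congr_mfderiv
    (congrArg (fun p => (1 : ℝ →L[ℝ] ℝ).smulRight (Y p : F)) (h ht).symm)

lemma isMIntegralCurveOn_comp {F' H' P' : Type*} [NormedAddCommGroup F'] [NormedSpace ℝ F']
    [TopologicalSpace H'] {I' : ModelWithCorners ℝ F' H'} [TopologicalSpace P']
    [ChartedSpace H' P'] {f : P → P'} {Y' : ∀ p : P', TangentSpace I' p}
    (hγ : IsMIntegralCurveOn γ Y J) (hf : ∀ t ∈ J, MDifferentiableAt I I' f (γ t))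
    (hY : ∀ t ∈ J, mfderiv I I' f (γ t) (Y (γ t)) = Y' (f (γ t))) :
    IsMIntegralCurveOn (f ∘ γ) Y' J := fun t ht => by
  refine ((hf t ht).hasMFDerivAt.comp_hasMFDerivWithinAt t (hγ t ht)).congr_mfderiv
    (ContinuousLinearMap.ext_ring ?_)
  change mfderiv I I' f (γ t) ((1 : ℝ) • Y (γ t)) = (1 : ℝ) • Y' (f (γ t))
  rw [one_smul, one_smul, hY t ht]

lemma hasDerivAt_comp_of_isMIntegralCurveAt {G : Type*} [NormedAddCommGroup G] [NormedSpace ℝ G]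
    {f : P → G} (hγ : IsMIntegralCurveAt γ Y t₀) (hf : MDifferentiableAt I 𝓘(ℝ, G) f (γ t₀)) :
    HasDerivAt (fun t => f (γ t)) (mvfderiv I f (γ t₀) (Y (γ t₀))) t₀ := by
  let L : ℝ →L[ℝ] G :=
    (mvfderiv I f (γ t₀)).comp ((1 : ℝ →L[ℝ] ℝ).smulRight (Y (γ t₀) : F))
  have hL : HasFDerivAt (fun t => f (γ t)) L t₀ :=
    hasMFDerivAt_iff_hasFDerivAt.1 (hf.hasMFDerivAt.comp t₀ hγ.hasMFDerivAt)
  have hL1 : L 1 = mvfderiv I f (γ t₀) (Y (γ t₀)) :=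
    congrArg (mvfderiv I f (γ t₀)) (one_smul ℝ (Y (γ t₀) : F))
  exact hL1 ▸ hL.hasDerivAt

theorem eqOn_of_isMIntegralCurveOn [IsManifold I 1 P] [BoundarylessManifold I P]
    [T2Space P] (hJ : IsOpen J) (hJc : IsPreconnected J) (ht₀ : t₀ ∈ J)
    (hY : ∀ t ∈ J, ContMDiffAt I I.tangent 1 (fun p => (⟨p, Y p⟩ : TangentBundle I P)) (γ t))
    (hγ : IsMIntegralCurveOn γ Y J) (hγ' : IsMIntegralCurveOn γ' Y J) (h : γ t₀ = γ' t₀) :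
    EqOn γ γ' J := by
  have hopen : ∀ t ∈ J, γ t = γ' t → γ =ᶠ[𝓝 t] γ' := fun t ht heq =>
    isMIntegralCurveAt_eventuallyEq_of_contMDiffAt_boundaryless (hY t ht)
      (hγ.isMIntegralCurveAt (hJ.mem_nhds ht)) (hγ'.isMIntegralCurveAt (hJ.mem_nhds ht)) heq
  have hclosed : ∀ t ∈ J, (∃ᶠ τ in 𝓝 t, γ τ = γ' τ) → γ t = γ' t := fun t ht hfreq => by
    by_contra hne
    exact hfreq (((hγ.isMIntegralCurveAt (hJ.mem_nhds ht)).continuousAt.ne_iff_eventually_ne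
      (hγ'.isMIntegralCurveAt (hJ.mem_nhds ht)).continuousAt).1 hne)
  have hsub : J ⊆ {t | t ∈ J ∧ γ t = γ' t} := by
    refine hJc.subset_of_closure_inter_subset ?_ ⟨t₀, ht₀, ht₀, h⟩ ?_
    · rw [isOpen_iff_mem_nhds]
      rintro t ⟨ht, heq⟩
      filter_upwards [hopen t ht heq, hJ.mem_nhds ht] with τ hτ hτJ
      exact ⟨hτJ, hτ⟩
    · rintro t ⟨ht, htJ⟩
      exact ⟨htJ, hclosed t htJ ((mem_closure_iff_frequently.1 ht).mono fun τ hτ => hτ.2)⟩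
  exact fun t ht => (hsub ht).2

end IntegralCurves

section Flow

variable {Z : ∀ x : M, TangentSpace 𝓘(ℝ, E) x}

lemma flow_eq_of_isMIntegralCurveOn [T2Space M] (hZ : SmoothFieldOn Z univ)
    {γ : ℝ → M} {a b t : ℝ} (h0 : 0 ∈ Ioo a b) (hγ : IsMIntegralCurveOn γ Z (Ioo a b))
    (ht : t ∈ Ioo a b) : flow Z t (γ 0) = γ t := by
  have hex : ∃ γ' : ℝ → M, γ' 0 = γ 0 ∧
      ∃ a b : ℝ, 0 ∈ Ioo a b ∧ t ∈ Ioo a b ∧ IsMIntegralCurveOn γ' Z (Ioo a b) :=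
    ⟨γ, rfl, a, b, h0, ht, hγ⟩
  rw [flow, dif_pos hex]
  obtain ⟨hc0, a', b', h0', ht', hc⟩ := hex.choose_spec
  exact eqOn_of_isMIntegralCurveOn (isOpen_Ioo.inter isOpen_Ioo)
    (ordConnected_Ioo.inter ordConnected_Ioo).isPreconnected ⟨h0, h0'⟩
    (fun τ _ => (contMDiffOn_univ.1 hZ).of_le (by norm_num) _)
    (hc.mono inter_subset_right) (hγ.mono inter_subset_left) hc0 ⟨ht, ht'⟩

omit [IsManifold 𝓘(ℝ, E) ∞ M] in
lemma flow_zero (Z : ∀ x : M, TangentSpace 𝓘(ℝ, E) x) : flow Z 0 = id := by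
  funext x
  rw [flow]
  split_ifs with h
  · exact h.choose_spec.1
  · rfl

end Flow

section ParallelTransport

namespace NonlinearConnection

variable {A : Set (TangentBundle 𝓘(ℝ, E) M)} (N : NonlinearConnection A)
  {Z : ∀ x : M, TangentSpace 𝓘(ℝ, E) x}

lemma isMIntegralCurveOn_proj {W : ℝ → TangentBundle 𝓘(ℝ, E) M} {J : Set ℝ}
    (hW : IsMIntegralCurveOn W (N.horizontalLift (isotropic Z)) J) (hWA : ∀ t ∈ J, W t ∈ A) :
    IsMIntegralCurveOn (fun t => (W t).proj) Z J :=
  isMIntegralCurveOn_comp hW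
    (fun t _ => contMDiff_tangentBundle_proj.mdifferentiable (by norm_num) (W t))
    fun t ht => N.dproj_horizontalLift (hWA t ht) (isotropic Z)

lemma isParallelOn_iff_isMIntegralCurveOn {γ : ℝ → M} {V : ∀ t : ℝ, TangentSpace 𝓘(ℝ, E) (γ t)}
    {J : Set ℝ} (hJ : IsOpen J) (hγ : IsMIntegralCurveOn γ Z J) :
    N.IsParallelOn γ V J ↔ (∀ t ∈ J, (⟨γ t, V t⟩ : TangentBundle 𝓘(ℝ, E) M) ∈ A) ∧
      IsMIntegralCurveOn (fun t => (⟨γ t, V t⟩ : TangentBundle 𝓘(ℝ, E) M))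
        (N.horizontalLift (isotropic Z)) J := by
  rw [isMIntegralCurveOn_iff_mfderiv_one hJ, ← forall₂_and]
  refine forall₂_congr fun t ht => and_congr_right fun htA => and_congr_right fun hd => ?_
  have hproj : dproj ⟨γ t, V t⟩ (mfderiv 𝓘(ℝ, ℝ) 𝓘(ℝ, E).tangent
      (fun τ => (⟨γ τ, V τ⟩ : TangentBundle 𝓘(ℝ, E) M)) t (1 : ℝ)) = Z (γ t) :=
    (mfderiv_comp_apply t (contMDiff_tangentBundle_proj.mdifferentiable (by norm_num) _) hd
      (1 : ℝ)).symm.trans ((isMIntegralCurveOn_iff_mfderiv_one hJ).1 hγ t ht).2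
  exact ⟨fun hmem => N.eq_horizontalLift htA hmem hproj,
    fun h => h ▸ N.horizontalLift_mem htA (isotropic Z)⟩

lemma exists_isParallelOn {W : ℝ → TangentBundle 𝓘(ℝ, E) M} {J : Set ℝ} (hJ : IsOpen J)
    (hW : IsMIntegralCurveOn W (N.horizontalLift (isotropic Z)) J) (hWA : ∀ t ∈ J, W t ∈ A)
    {γ : ℝ → M} (hγ : ∀ t ∈ J, γ t = (W t).proj) :
    ∃ V : ∀ t : ℝ, TangentSpace 𝓘(ℝ, E) (γ t), N.IsParallelOn γ V J ∧
      ∀ t ∈ J, (⟨γ t, V t⟩ : TangentBundle 𝓘(ℝ, E) M) = W t := by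
  have hlift (t : ℝ) : ∃ w : TangentSpace 𝓘(ℝ, E) (γ t),
      t ∈ J → (⟨γ t, w⟩ : TangentBundle 𝓘(ℝ, E) M) = W t := by
    by_cases ht : t ∈ J
    · rw [hγ t ht]
      exact ⟨(W t).2, fun _ => rfl⟩
    · exact ⟨0, fun h => absurd h ht⟩
  choose V hV using hlift
  refine ⟨V, ?_, hV⟩
  rw [N.isParallelOn_iff_isMIntegralCurveOn hJ
    (isMIntegralCurveOn_congr (N.isMIntegralCurveOn_proj hW hWA) hγ)]
  exact ⟨fun t ht => (hV t ht).symm ▸ hWA t ht, isMIntegralCurveOn_congr hW hV⟩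

theorem mk_parallelTransport_eq [T2Space M] (hA : IsOpen A)
    (hZ : SmoothFieldOn Z univ) {W : ℝ → TangentBundle 𝓘(ℝ, E) M} {a b : ℝ} (h0 : 0 ∈ Ioo a b)
    (hW : IsMIntegralCurveOn W (N.horizontalLift (isotropic Z)) (Ioo a b))
    (hWA : ∀ t ∈ Ioo a b, W t ∈ A) {γ : ℝ → M} (hγ : ∀ t ∈ Ioo a b, γ t = (W t).proj)
    {t : ℝ} (ht : t ∈ Ioo a b) :
    (⟨γ t, N.parallelTransport γ t (W 0)⟩ : TangentBundle 𝓘(ℝ, E) M) = W t := by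
  have : T2Space (TangentBundle 𝓘(ℝ, E) M) := t2Space_totalSpace _
  have hex : ∃ V : ∀ τ : ℝ, TangentSpace 𝓘(ℝ, E) (γ τ),
      (⟨γ 0, V 0⟩ : TangentBundle 𝓘(ℝ, E) M) = W 0 ∧
      ∃ a b : ℝ, 0 ∈ Ioo a b ∧ t ∈ Ioo a b ∧ N.IsParallelOn γ V (Ioo a b) := by
    obtain ⟨V, hV, hVW⟩ := N.exists_isParallelOn isOpen_Ioo hW hWA hγ
    exact ⟨V, hVW 0 h0, a, b, h0, ht, hV⟩
  rw [parallelTransport, dif_pos hex]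
  obtain ⟨hV0, a', b', h0', ht', hV⟩ := hex.choose_spec
  have hJ : IsOpen (Ioo a b ∩ Ioo a' b') := isOpen_Ioo.inter isOpen_Ioo
  have hγZ : IsMIntegralCurveOn γ Z (Ioo a b) :=
    isMIntegralCurveOn_congr (N.isMIntegralCurveOn_proj hW hWA) hγ
  have hVW := ((N.isParallelOn_iff_isMIntegralCurveOn hJ (hγZ.mono inter_subset_left)).1
    fun τ hτ => hV τ hτ.2).2
  exact (eqOn_of_isMIntegralCurveOn hJ (ordConnected_Ioo.inter ordConnected_Ioo).isPreconnected
    ⟨h0, h0'⟩ (fun τ hτ => (N.contMDiffAt_horizontalLift hA (hWA τ hτ.1)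
      (contMDiffAt_isotropic hZ univ_mem)).of_le (by norm_num))
    (hW.mono inter_subset_left) hVW hV0.symm ⟨ht, ht'⟩).symm

lemma exists_isMIntegralCurveOn_horizontalLift [CompleteSpace E] (hA : IsOpen A)
    {v : TangentBundle 𝓘(ℝ, E) M} (hv : v ∈ A)
    {Z : ∀ v : TangentBundle 𝓘(ℝ, E) M, TangentSpace 𝓘(ℝ, E) v.proj}
    (hZ : ContMDiffAt 𝓘(ℝ, E).tangent 𝓘(ℝ, E).tangent ∞
      (fun w => (⟨w.proj, Z w⟩ : TangentBundle 𝓘(ℝ, E) M)) v) :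
    ∃ W : ℝ → TangentBundle 𝓘(ℝ, E) M, W 0 = v ∧ ∃ ε > 0,
      IsMIntegralCurveOn W (N.horizontalLift Z) (Ioo (-ε) ε) ∧ ∀ t ∈ Ioo (-ε) ε, W t ∈ A := by
  obtain ⟨W, rfl, hW⟩ := exists_isMIntegralCurveAt_of_contMDiffAt_boundaryless (t₀ := 0)
    ((N.contMDiffAt_horizontalLift hA hv hZ).of_le (by norm_num : (1 : ℕ∞ω) ≤ ∞))
  obtain ⟨s, hs, hWs⟩ := isMIntegralCurveAt_iff.1 hW
  obtain ⟨ε, hε, hball⟩ :=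
    Metric.mem_nhds_iff.1 (inter_mem hs (hW.continuousAt.preimage_mem_nhds (hA.mem_nhds hv)))
  rw [Real.ball_eq_Ioo, zero_sub, zero_add] at hball
  exact ⟨W, rfl, ε, hε, hWs.mono fun t ht => (hball ht).1, fun t ht => (hball ht).2⟩

end NonlinearConnection

end ParallelTransport

section FlowDerivative

lemma isMIntegralCurveOn_extChartAt_symm_comp {F H P : Type*} [NormedAddCommGroup F]
    [NormedSpace ℝ F] [TopologicalSpace H] {I : ModelWithCorners ℝ F H} [I.Boundaryless]
    [TopologicalSpace P] [ChartedSpace H P] [IsManifold I 1 P] {p : P}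
    {Y : ∀ q : P, TangentSpace I q} {c : ℝ → F} {J : Set ℝ}
    (hc : IsMIntegralCurveOn (I := 𝓘(ℝ, F)) c (chartPullback I p Y) J)
    (hcp : ∀ t ∈ J, c t ∈ (extChartAt I p).target) :
    IsMIntegralCurveOn ((extChartAt I p).symm ∘ c) Y J := by
  refine isMIntegralCurveOn_comp hc (fun t ht => ?_) fun t ht => ?_
  · exact ((contMDiffOn_extChartAt_symm (n := 1) p).contMDiffAt
      ((isOpen_extChartAt_target p).mem_nhds (hcp t ht))).mdifferentiableAt one_ne_zero
  · rw [← mfderivWithin_univ, ← I.range_eq_univ]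
    exact (isInvertible_mfderivWithin_extChartAt_symm (hcp t ht)).self_apply_inverse _

lemma chartReading_comp_eventuallyEq_chartPullback (x₀ : M) (Z : ∀ x : M, TangentSpace 𝓘(ℝ, E) x) :
    (fun y => chartReading x₀ y (Z y)) =ᶠ[𝓝 x₀]
      chartPullback 𝓘(ℝ, E) x₀ Z ∘ extChartAt 𝓘(ℝ, E) x₀ := by
  filter_upwards [extChartAt_source_mem_nhds (I := 𝓘(ℝ, E)) x₀] with y hy
  exact (chartPullback_extChartAt hy Z).symm

lemma contDiffAt_chartPullback {x₀ : M} {Z : ∀ x : M, TangentSpace 𝓘(ℝ, E) x} {U : Set M}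
    (hZ : SmoothFieldOn Z U) (hU : U ∈ 𝓝 x₀) :
    ContDiffAt ℝ ∞ (chartPullback 𝓘(ℝ, E) x₀ Z) (extChartAt 𝓘(ℝ, E) x₀ x₀) := by
  refine (contDiffAt_comp_extChartAt_symm
    (contMDiffAt_chartReading (b := id) (hZ.contMDiffAt hU))).congr_of_eventuallyEq ?_
  filter_upwards [extChartAt_target_mem_nhds (I := 𝓘(ℝ, E)) x₀] with p hp
  have h := chartPullback_extChartAt ((extChartAt 𝓘(ℝ, E) x₀).map_target hp) Z
  rwa [(extChartAt 𝓘(ℝ, E) x₀).right_inv hp] at h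

lemma mdifferentiableAt_chartReading {x₀ : M} {Z : ∀ x : M, TangentSpace 𝓘(ℝ, E) x} {U : Set M}
    (hZ : SmoothFieldOn Z U) (hU : U ∈ 𝓝 x₀) :
    MDifferentiableAt 𝓘(ℝ, E) 𝓘(ℝ, E) (fun y => chartReading x₀ y (Z y)) x₀ :=
  (contMDiffAt_chartReading (b := id) (hZ.contMDiffAt hU)).mdifferentiableAt (by norm_num)

lemma chartReading_mfderiv {f : M → M} {x₀ : M} {g : E → E} {g' : E →L[ℝ] E}
    (hf : ∀ᶠ y in 𝓝 x₀, f y ∈ (extChartAt 𝓘(ℝ, E) x₀).source ∧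
      extChartAt 𝓘(ℝ, E) x₀ (f y) = g (extChartAt 𝓘(ℝ, E) x₀ y))
    (hg : HasFDerivAt g g' (extChartAt 𝓘(ℝ, E) x₀ x₀)) (u : TangentSpace 𝓘(ℝ, E) x₀) :
    chartReading x₀ (f x₀) (mfderiv 𝓘(ℝ, E) 𝓘(ℝ, E) f x₀ u) = g' (chartReading x₀ x₀ u) := by
  let φ := extChartAt 𝓘(ℝ, E) x₀
  have hx₀ : x₀ ∈ φ.source := mem_extChartAt_source x₀
  obtain ⟨hsrc, hfx₀⟩ := hf.self_of_nhds
  have hφf : φ ∘ f =ᶠ[𝓝 x₀] g ∘ φ := hf.mono fun y hy => hy.2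
  have hsymm : MDifferentiableAt 𝓘(ℝ, E) 𝓘(ℝ, E) φ.symm (g (φ x₀)) :=
    ((contMDiffOn_extChartAt_symm (n := 1) x₀).contMDiffAt ((isOpen_extChartAt_target x₀).mem_nhds
      (hfx₀ ▸ φ.map_source hsrc))).mdifferentiableAt one_ne_zero
  have hdf : MDifferentiableAt 𝓘(ℝ, E) 𝓘(ℝ, E) f x₀ := by
    refine (MDifferentiableAt.comp x₀ (f := g ∘ φ) hsymm
      (hasMFDerivAt_of_eventuallyEq_comp_extChartAt hx₀ hg.differentiableAt
        EventuallyEq.rfl).mdifferentiableAt).congr_of_eventuallyEq (hf.mono fun y hy => ?_)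
    rw [Function.comp_apply, Function.comp_apply, ← hy.2, φ.left_inv hy.1]
  have hchain := mfderiv_comp_apply (I' := 𝓘(ℝ, E)) (I'' := 𝓘(ℝ, E)) x₀
    (mdifferentiableAt_extChartAt (by simpa using hsrc)) hdf u
  have hread := mvfderiv_of_eventuallyEq_comp_extChartAt hx₀ hg.differentiableAt hφf u
  rw [hg.fderiv] at hread
  exact hchain.symm.trans hread

variable [CompleteSpace E] [T2Space M] {Z : ∀ x : M, TangentSpace 𝓘(ℝ, E) x}

lemma exists_extChartAt_flow_eq (hZ : SmoothFieldOn Z univ) (x₀ : M) :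
    ∃ ε > 0, ∃ (α : E → ℝ → E) (D : ℝ → E →L[ℝ] E),
      (∀ᶠ y in 𝓝 x₀, ∀ t ∈ Ioo (-ε) ε, flow Z t y ∈ (extChartAt 𝓘(ℝ, E) x₀).source ∧
        extChartAt 𝓘(ℝ, E) x₀ (flow Z t y) = α (extChartAt 𝓘(ℝ, E) x₀ y) t) ∧
      (∀ t ∈ Ioo (-ε) ε, HasFDerivAt (fun p => α p t) (D t) (extChartAt 𝓘(ℝ, E) x₀ x₀)) ∧
      HasDerivAt D (fderiv ℝ (chartPullback 𝓘(ℝ, E) x₀ Z) (extChartAt 𝓘(ℝ, E) x₀ x₀)) 0 := by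
  let φ := extChartAt 𝓘(ℝ, E) x₀
  obtain ⟨ε, hε, α, D, hα, hD, hD'⟩ := exists_localFlow_hasFDerivAt
    ((contDiffAt_chartPullback (x₀ := x₀) hZ univ_mem).of_le (by norm_cast))
    (extChartAt_target_mem_nhds (I := 𝓘(ℝ, E)) x₀)
  refine ⟨ε, hε, α, D, ?_, hD, hD'⟩
  filter_upwards [extChartAt_source_mem_nhds (I := 𝓘(ℝ, E)) x₀,
    (continuousAt_extChartAt (I := 𝓘(ℝ, E)) x₀).eventually hα] with y hy ⟨hα0, hαt⟩ t ht
  have hflow := flow_eq_of_isMIntegralCurveOn hZ ⟨neg_lt_zero.2 hε, hε⟩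
    (isMIntegralCurveOn_extChartAt_symm_comp
      (fun τ hτ => (hαt τ hτ).1.hasFDerivAt.hasMFDerivAt.hasMFDerivWithinAt)
      fun τ hτ => (hαt τ hτ).2) ht
  rw [Function.comp_apply, Function.comp_apply, hα0, φ.left_inv hy] at hflow
  rw [hflow]
  exact ⟨φ.map_target (hαt t ht).2, φ.right_inv (hαt t ht).2⟩

theorem hasDerivAt_chartReading_mfderiv_flow (hZ : SmoothFieldOn Z univ) (x₀ : M)
    (u : TangentSpace 𝓘(ℝ, E) x₀) :
    HasDerivAt (fun t => chartReading x₀ (flow Z t x₀)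
        (mfderiv 𝓘(ℝ, E) 𝓘(ℝ, E) (flow Z t) x₀ u))
      (mvfderiv 𝓘(ℝ, E) (fun y => chartReading x₀ y (Z y)) x₀ u) 0 := by
  obtain ⟨ε, hε, α, D, hα, hD, hD'⟩ := exists_extChartAt_flow_eq hZ x₀
  have hz := (contDiffAt_chartPullback (x₀ := x₀) hZ univ_mem).differentiableAt (by norm_num)
  rw [mvfderiv_of_eventuallyEq_comp_extChartAt (mem_extChartAt_source x₀) hz
    (chartReading_comp_eventuallyEq_chartPullback x₀ Z)]
  have hDu := hD'.clm_apply (hasDerivAt_const (0 : ℝ) (chartReading x₀ x₀ u))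
  rw [map_zero, add_zero] at hDu
  refine hDu.congr_of_eventuallyEq ?_
  filter_upwards [isOpen_Ioo.mem_nhds ⟨neg_lt_zero.2 hε, hε⟩] with t ht
  exact chartReading_mfderiv (hα.mono fun y hy => hy t ht) (hD t ht) u

end FlowDerivative

section LieDerivative

variable {A : Set (TangentBundle 𝓘(ℝ, E) M)} {s : ℕ}

lemma chartReading_mlieBracket [CompleteSpace E] {x₀ : M}
    {Z X : ∀ x : M, TangentSpace 𝓘(ℝ, E) x} {U : Set M} (hZ : SmoothFieldOn Z U)
    (hX : SmoothFieldOn X U) (hU : U ∈ 𝓝 x₀) :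
    chartReading x₀ x₀ (VectorField.mlieBracket 𝓘(ℝ, E) Z X x₀) =
      mvfderiv 𝓘(ℝ, E) (fun y => chartReading x₀ y (X y)) x₀ (Z x₀) -
        mvfderiv 𝓘(ℝ, E) (fun y => chartReading x₀ y (Z y)) x₀ (X x₀) := by
  have : IsManifold 𝓘(ℝ, E) 2 M := IsManifold.of_le (n := ∞) (by norm_cast)
  exact mvfderiv_apply_mlieBracket contMDiffAt_extChartAt
    ((hZ.contMDiffAt hU).mdifferentiableAt (by norm_num))
    ((hX.contMDiffAt hU).mdifferentiableAt (by norm_num))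

theorem NonlinearConnection.lieBracketField_isotropic [CompleteSpace E]
    (N : NonlinearConnection A) (hA : IsOpen A) {v : TangentBundle 𝓘(ℝ, E) M} (hv : v ∈ A)
    {Z X : ∀ x : M, TangentSpace 𝓘(ℝ, E) x} {U : Set M} (hZ : SmoothFieldOn Z U)
    (hX : SmoothFieldOn X U) (hU : U ∈ 𝓝 v.proj) :
    N.lieBracketField (isotropic Z) (isotropic X) v =
      VectorField.mlieBracket 𝓘(ℝ, E) Z X v.proj := by
  have : IsManifold 𝓘(ℝ, E) 2 M := IsManifold.of_le (n := ∞) (by norm_cast)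
  have hlift {Y : ∀ x : M, TangentSpace 𝓘(ℝ, E) x} (hY : SmoothFieldOn Y U) :=
    (N.contMDiffAt_horizontalLift hA hv (contMDiffAt_isotropic hY hU)).mdifferentiableAt
      (by norm_num)
  have hrelated (Y : ∀ x : M, TangentSpace 𝓘(ℝ, E) x) :
      ∀ᶠ w in 𝓝 v, dproj w (N.horizontalLift (isotropic Y) w) = Y w.proj :=
    (hA.eventually_mem hv).mono fun w hw => N.dproj_horizontalLift hw (isotropic Y)
  exact mfderiv_mlieBracket_of_related ((contMDiff_tangentBundle_proj v).of_le (by norm_cast))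
    (hlift hZ) (hlift hX) ((hZ.contMDiffAt hU).mdifferentiableAt (by norm_num))
    ((hX.contMDiffAt hU).mdifferentiableAt (by norm_num)) (hrelated Z) (hrelated X)

namespace AnisotropicForm

variable (η : AnisotropicForm A s)

/-- The form `η_w` read in the chart at `x₀`, as a multilinear map on the model space: this lets
`η_w` vary with `w` in a fixed space. It is meaningful only when `π(w)` lies in the chart. -/
def chartForm (x₀ : M) (w : TangentBundle 𝓘(ℝ, E) M) :
    MultilinearMap ℝ (fun _ : Fin s => E) ℝ :=
  (η.form w).toMultilinearMap.compLinearMap fun _ =>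
    ((trivializationAt E (TangentSpace 𝓘(ℝ, E)) x₀).symmL ℝ w.proj).toLinearMap

lemma form_eq_chartForm {x₀ : M} {w : TangentBundle 𝓘(ℝ, E) M}
    (hw : w.proj ∈ (chartAt E x₀).source) (ξ : Fin s → TangentSpace 𝓘(ℝ, E) w.proj) :
    η.form w ξ = η.chartForm x₀ w fun i => chartReading x₀ w.proj (ξ i) :=
  congrArg (η.form w) (funext fun i => (chartField_chartReading hw (ξ i)).symm)

lemma mdifferentiableAt_form (hA : IsOpen A) {v : TangentBundle 𝓘(ℝ, E) M} (hv : v ∈ A)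
    {U : Set M} (hU : IsOpen U) (hvU : v.proj ∈ U) {X : Fin s → ∀ x : M, TangentSpace 𝓘(ℝ, E) x}
    (hX : ∀ i, SmoothFieldOn (X i) U) :
    MDifferentiableAt 𝓘(ℝ, E).tangent 𝓘(ℝ, ℝ)
      (fun w : TangentBundle 𝓘(ℝ, E) M => η.form w fun i => X i w.proj) v :=
  ((η.smooth U hU X hX).contMDiffAt (inter_mem (hA.mem_nhds hv)
    ((contMDiff_tangentBundle_proj v).continuousAt.preimage_mem_nhds
      (hU.mem_nhds hvU)))).mdifferentiableAt (by norm_num)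

lemma mdifferentiableAt_chartForm (hA : IsOpen A) {x₀ : M} {v : TangentBundle 𝓘(ℝ, E) M}
    (hv : v ∈ A) (hx₀ : v.proj ∈ (chartAt E x₀).source) (u : Fin s → E) :
    MDifferentiableAt 𝓘(ℝ, E).tangent 𝓘(ℝ, ℝ) (fun w => η.chartForm x₀ w u) v :=
  η.mdifferentiableAt_form hA hv (chartAt E x₀).open_source hx₀
    fun i => smoothFieldOn_chartField x₀ (u i)

end AnisotropicForm

lemma NonlinearConnection.lieBracketForm_isotropic [CompleteSpace E]
    (N : NonlinearConnection A) (hA : IsOpen A) (η : AnisotropicForm A s)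
    {v : TangentBundle 𝓘(ℝ, E) M} (hv : v ∈ A) {Z : ∀ x : M, TangentSpace 𝓘(ℝ, E) x} {U : Set M}
    (hZ : SmoothFieldOn Z U) (hU : U ∈ 𝓝 v.proj) {X : Fin s → ∀ x : M, TangentSpace 𝓘(ℝ, E) x}
    (hX : ∀ i, SmoothFieldOn (X i) U) :
    N.lieBracketForm (isotropic Z) η X v =
      mvfderiv 𝓘(ℝ, E).tangent (fun w => η.form w fun i => X i w.proj) v
          (N.horizontalLift (isotropic Z) v) -
        ∑ i, η.chartForm v.proj v (Function.update
          (fun j => chartReading v.proj v.proj (X j v.proj)) i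
          (mvfderiv 𝓘(ℝ, E) (fun y => chartReading v.proj y (X i y)) v.proj (Z v.proj) -
            mvfderiv 𝓘(ℝ, E) (fun y => chartReading v.proj y (Z y)) v.proj (X i v.proj))) := by
  refine congrArg (_ - ·) (Finset.sum_congr rfl fun i _ => ?_)
  rw [N.lieBracketField_isotropic hA hv hZ (hX i) hU, ← chartReading_mlieBracket hZ (hX i) hU,
    η.form_eq_chartForm (mem_chart_source E v.proj)]
  exact congrArg _ (funext fun j =>
    Function.apply_update (fun _ => chartReading v.proj v.proj) _ i _ j)

variable [T2Space M] {N : NonlinearConnection A}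
  {Z : ∀ x : M, TangentSpace 𝓘(ℝ, E) x} (η : AnisotropicForm A s)

lemma flowPullback_apply_eq_chartForm (hA : IsOpen A) (hZ : SmoothFieldOn Z univ)
    {W : ℝ → TangentBundle 𝓘(ℝ, E) M} {a b : ℝ} (h0 : 0 ∈ Ioo a b)
    (hW : IsMIntegralCurveOn W (N.horizontalLift (isotropic Z)) (Ioo a b))
    (hWA : ∀ t ∈ Ioo a b, W t ∈ A) {t : ℝ} (ht : t ∈ Ioo a b) {x₀ : M}
    (hx₀ : (W t).proj ∈ (chartAt E x₀).source)
    (u : Fin s → TangentSpace 𝓘(ℝ, E) (W 0).proj) :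
    flowPullback N Z t η (W 0) u = η.chartForm x₀ (W t) fun i =>
      chartReading x₀ (flow Z t (W 0).proj)
        (mfderiv 𝓘(ℝ, E) 𝓘(ℝ, E) (flow Z t) (W 0).proj (u i)) := by
  have htransport := N.mk_parallelTransport_eq hA hZ h0 hW hWA
    (fun τ hτ => flow_eq_of_isMIntegralCurveOn hZ h0 (N.isMIntegralCurveOn_proj hW hWA) hτ) ht
  have hform : ∀ w, w = W t → ∀ ξ : Fin s → TangentSpace 𝓘(ℝ, E) w.proj,
      η.form w ξ = η.chartForm x₀ (W t) fun i => chartReading x₀ w.proj (ξ i) := by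
    rintro _ rfl ξ
    exact η.form_eq_chartForm hx₀ ξ
  exact hform _ htransport _

lemma flowPullback_zero [CompleteSpace E] (hA : IsOpen A) (hZ : SmoothFieldOn Z univ)
    {v : TangentBundle 𝓘(ℝ, E) M} (hv : v ∈ A) : flowPullback N Z 0 η v = η.form v := by
  obtain ⟨W, rfl, ε, hε, hW, hWA⟩ :=
    N.exists_isMIntegralCurveOn_horizontalLift hA hv (contMDiffAt_isotropic hZ univ_mem)
  ext u
  rw [flowPullback_apply_eq_chartForm η hA hZ ⟨neg_lt_zero.2 hε, hε⟩ hW hWA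
    ⟨neg_lt_zero.2 hε, hε⟩ (mem_chart_source E (W 0).proj), flow_zero, mfderiv_id]
  exact (η.form_eq_chartForm (mem_chart_source E (W 0).proj) u).symm

theorem hasDerivAt_flowPullback_apply [FiniteDimensional ℝ E] (hA : IsOpen A)
    (hZ : SmoothFieldOn Z univ)
    {v : TangentBundle 𝓘(ℝ, E) M} (hv : v ∈ A) {U : Set M} (hU : IsOpen U) (hvU : v.proj ∈ U)
    {X : Fin s → ∀ x : M, TangentSpace 𝓘(ℝ, E) x} (hX : ∀ i, SmoothFieldOn (X i) U) :
    HasDerivAt (fun t => flowPullback N Z t η v fun i => X i v.proj)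
      (N.lieBracketForm (isotropic Z) η X v) 0 := by
  obtain ⟨W, rfl, ε, hε, hW, hWA⟩ :=
    N.exists_isMIntegralCurveOn_horizontalLift hA hv (contMDiffAt_isotropic hZ univ_mem)
  have h0 : (0 : ℝ) ∈ Ioo (-ε) ε := ⟨neg_lt_zero.2 hε, hε⟩
  have hW0 := hW.isMIntegralCurveAt (isOpen_Ioo.mem_nhds h0)
  have hγ0 := (N.isMIntegralCurveOn_proj hW hWA).isMIntegralCurveAt (isOpen_Ioo.mem_nhds h0)
  have hsrc := hγ0.continuousAt.eventually (chart_source_mem_nhds E (W 0).proj)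
  have hηX : HasDerivAt (fun t => η.chartForm (W 0).proj (W t) fun i =>
      chartReading (W 0).proj (W t).proj (X i (W t).proj)) _ 0 :=
    (hasDerivAt_comp_of_isMIntegralCurveAt hW0
      (η.mdifferentiableAt_form hA hv hU hvU hX)).congr_of_eventuallyEq
        (hsrc.mono fun t ht => (η.form_eq_chartForm ht _).symm)
  have hfields : HasDerivAt (fun t i => chartReading (W 0).proj (W t).proj (X i (W t).proj)) _ 0 :=
    hasDerivAt_pi.2 fun i => hasDerivAt_comp_of_isMIntegralCurveAt hγ0
      (mdifferentiableAt_chartReading (hX i) (hU.mem_nhds hvU))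
  have hpushed := hasDerivAt_pi.2 fun i =>
    hasDerivAt_chartReading_mfderiv_flow hZ (W 0).proj (X i (W 0).proj)
  have hinitial : (fun i => chartReading (W 0).proj (W 0).proj (X i (W 0).proj)) = fun i =>
      chartReading (W 0).proj (flow Z 0 (W 0).proj)
        (mfderiv 𝓘(ℝ, E) 𝓘(ℝ, E) (flow Z 0) (W 0).proj (X i (W 0).proj)) := by
    rw [flow_zero, mfderiv_id]
    rfl
  have hderiv := hasDerivAt_multilinear_apply_of_eq
    (fun u => (hasDerivAt_comp_of_isMIntegralCurveAt hW0 (η.mdifferentiableAt_chartForm hA hv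
      (mem_chart_source E (W 0).proj) u)).differentiableAt) hfields hpushed hinitial hηX
  rw [N.lieBracketForm_isotropic hA η hv (hZ.mono (subset_univ U)) (hU.mem_nhds hvU) hX]
  simp only [← hinitial] at hderiv
  refine hderiv.congr_of_eventuallyEq ?_
  filter_upwards [isOpen_Ioo.mem_nhds h0, hsrc] with t ht hts
  exact flowPullback_apply_eq_chartForm η hA hZ h0 hW hWA ht hts _

end LieDerivative

end AnisotropicLie

end

theorem mainTheorem8 {E : Type*} [NormedAddCommGroup E] [NormedSpace ℝ E]
    [FiniteDimensional ℝ E] {M : Type*} [TopologicalSpace M] [T2Space M] [ChartedSpace E M]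
    [IsManifold 𝓘(ℝ, E) ∞ M] {A : Set (TangentBundle 𝓘(ℝ, E) M)} (hA : IsOpen A)
    (N : AnisotropicLie.NonlinearConnection A)
    (Z : ∀ x : M, TangentSpace 𝓘(ℝ, E) x) (hZ : AnisotropicLie.SmoothFieldOn Z univ)
    {s : ℕ} (η : AnisotropicLie.AnisotropicForm A s)
    (v : TangentBundle 𝓘(ℝ, E) M) (hv : v ∈ A)
    (U : Set M) (hU : IsOpen U) (hvU : v.proj ∈ U)
    (X : Fin s → ∀ x : M, TangentSpace 𝓘(ℝ, E) x)
    (hX : ∀ i, AnisotropicLie.SmoothFieldOn (X i) U) :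
    Tendsto
      (fun t : ℝ => (t⁻¹ • (AnisotropicLie.flowPullback N Z t η v - η.form v))
        (fun i => X i v.proj))
      (𝓝[≠] 0)
      (𝓝 (N.lieBracketForm (AnisotropicLie.isotropic Z) η X v)) := by
  open AnisotropicLie in
  have hderiv := hasDerivAt_flowPullback_apply (N := N) η hA hZ hv hU hvU hX
  refine (hasDerivAt_iff_tendsto_slope.1 hderiv).congr fun t => ?_
  rw [slope_def_module, sub_zero, flowPullback_zero η hA hZ hv]
  rfl
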